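/- Let $\mathcal G=(V,E)$ be a finite directed acyclic graph. Let $\mathcal M_{\mathcal G}$ be the Gaussian DAG model on $\mathcal G$, i.e. the set of all covariance matrices $\Sigma=(I-\Lambda)^{-T}\,\Omega\,(I-\Lambda)^{-1}$, where $\Lambda\in\mathbb R^{V\times V}$ satisfies $\lambda_{uv}=0$ whenever $u\to v\notin E$, and $\Omega$ is a diagonal matrix with positive diagonal entries. For a positive definite matrix $\Sigma$, $K\subseteq V$ and $a,b\in V\setminus K$ put $\sigma_{ab\cdot K}=\Sigma_{ab}-\Sigma_{a,K}\Sigma_{K,K}^{-1}\Sigma_{K,b}$ and let $\rho_{ab\cdot K}=\sigma_{ab\cdot K}/\sqrt{\sigma_{aa\cdot K}\,\sigma_{bb\cdot K}}$ be the partial correlation of $a$ and $b$ given $K$. For $\delta\ge 0$ let $\mathcal M_{a\perp_\delta b|K}$ be the set of positive definite matrices with $|\rho_{ab\cdot K}|\le\delta$. A set $C\subseteq V$ d-separates $a$ and $b$ ($a\neq b$, $a,b\notin C$) if every path between $a$ and $b$ (a sequence of distinct vertices, consecutive ones joined by an edge in either direction) contains a vertex $k$ that is either a non-collider on the path with $k\in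 C$, or a collider on the path such that neither $k$ nor any descendant of $k$ belongs to $C$; here $k$ is a collider on the path if the path contains consecutive edges $u\to k\leftarrow v$. Let $i,j,l\in V$ be distinct vertices and let $K\subseteq V\setminus\{i,j,l\}$ be such that $K$ d-separates neither $i$ from $j$ nor $i$ from $l$. Then $$\mathcal M_{\mathcal G}\cap\mathcal M_{i\perp_\delta j|K}\subseteq\mathcal M_{i\perp_\delta l|K}\quad\text{for all }\delta\in[0,1]$$ if and only if $\{j\}\cup K$ d-separates $i$ from $l$. -/

import Mathlib

/-! Directed acyclic graphs, d-separation, Gaussian DAG models and partial correlations. -/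

namespace GaussianDAG

section Graph

variable {V : Type*}

/-- A directed graph is acyclic if no vertex is reachable from itself by a directed path with at
least one edge. In particular there are no loops and at most one edge between two vertices. -/
def IsDAG (G : Digraph V) : Prop :=
  ∀ v, ¬ Relation.TransGen G.Adj v v

/-- `p` lists the vertices of a (not necessarily directed) path from `i` to `j` in `G`: the
vertices are distinct and consecutive ones are joined by an edge in one of the two directions. -/
structure IsPath (G : Digraph V) (i j : V) (p : List V) : Prop where
  nodup : p.Nodup
  chain : p.IsChain (fun a b => G.Adj a b ∨ G.Adj b a)
  head_eq : p.head? = some i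
  last_eq : p.getLast? = some j

/-- The vertex `k` is a collider on the path `p`: the path has consecutive edges `a → k ← b`. -/
def IsCollider (G : Digraph V) (p : List V) (k : V) : Prop :=
  ∃ a b, [a, k, b] <:+: p ∧ G.Adj a k ∧ G.Adj b k

/-- `C` d-separates `A` and `B` in `G` (a notion used for pairwise disjoint `A`, `B`, `C`): every
path from a vertex of `A` to a vertex of `B` contains a vertex that is either a non-collider in
`C`, or a collider which is not in `C` and has no descendant in `C`. -/
def DSep (G : Digraph V) (A B C : Finset V) : Prop :=
  ∀ i ∈ A, ∀ j ∈ B, ∀ p : List V, IsPath G i j p →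
    ∃ k ∈ p, (¬ IsCollider G p k ∧ k ∈ C) ∨
      (IsCollider G p k ∧ k ∉ C ∧ ∀ d, Relation.TransGen G.Adj k d → d ∉ C)

end Graph

noncomputable section Model

open Matrix

variable {V : Type*} [Fintype V] [DecidableEq V]

/-- The matrices of edge weights on `G`: the entry `Λ u v` is an arbitrary real number if `u → v`
is an edge, and it is zero otherwise. -/
def edgeWeights (G : Digraph V) : Set (Matrix V V ℝ) :=
  {L | ∀ u v, ¬ G.Adj u v → L u v = 0}

/-- The parametrization `(Λ, ω) ↦ (I - Λ)⁻ᵀ diag(ω) (I - Λ)⁻¹`. -/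
def semCov (q : Matrix V V ℝ × (V → ℝ)) : Matrix V V ℝ :=
  ((1 - q.1)⁻¹)ᵀ * diagonal q.2 * (1 - q.1)⁻¹

/-- The Gaussian DAG model on `G`, a set of covariance matrices: the image of the
parametrization on all edge weights and all positive error variances. -/
def dagModel (G : Digraph V) : Set (Matrix V V ℝ) :=
  semCov '' (edgeWeights G ×ˢ {w : V → ℝ | ∀ v, 0 < w v})

/-- The conditional covariance matrix `Σ - Σ_{V,K} (Σ_{K,K})⁻¹ Σ_{K,V}` given `K`. -/
def condCov (S : Matrix V V ℝ) (K : Finset V) : Matrix V V ℝ :=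
  S - S.submatrix id (fun k : K => (k : V)) *
      (S.submatrix (fun k : K => (k : V)) (fun k : K => (k : V)))⁻¹ *
      S.submatrix (fun k : K => (k : V)) id

/-- The partial correlation `ρ_{i,j·K}`. -/
def partialCorr (S : Matrix V V ℝ) (i j : V) (K : Finset V) : ℝ :=
  condCov S K i j / (√(condCov S K i i) * √(condCov S K j j))

/-- The covariance (positive definite) matrices with `|ρ_{i,j·K}| ≤ δ`. -/
def approxCIModel (i j : V) (K : Finset V) (δ : ℝ) : Set (Matrix V V ℝ) :=
  {S | S.PosDef ∧ |partialCorr S i j K| ≤ δ}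

end Model

end GaussianDAG

namespace GaussianDAG

/-! ### Conditional covariances as solutions of linear equations in the precision matrix -/

section CondCov

open Matrix

variable {V : Type*} [DecidableEq V]

/-! Sufficiency is the global Markov property. Vanishing of σ_{il·jK} means σ_{il·K} σ_{jj·K} =
σ_{ij·K} σ_{jl·K}, so ρ_{il·K} = ρ_{ij·K} ρ_{jl·K} (`partialCorr_eq_mul`), and the last factor is at
most 1 in absolute value.

For necessity, d-connection makes each of σ_{il·K} and σ_{il·jK} nonzero for some edge weights. Both
are analytic in the weights, so they are nonzero simultaneously (`exists_condCov_ne_zero_and`). From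
such a point only the mechanism of j is changed: the weights into j are scaled by t and its error
variance becomes ω. One rank-one term of the precision matrix is affected, so the conditional
covariances given K are explicit rational functions of t and ω (`exists_condCov_update`). A case
analysis (`exists_perturbation`) then finds t and ω with |ρ_{ij·K}| < |ρ_{il·K}|, and δ = |ρ_{ij·K}|
violates the inclusion.

The Markov property and its generic converse are proved by building the graph up one sink at a time.
The induction uses active walks, which concatenate and decompose more easily than paths; walks and
open paths are converted into each other separately. -/

theorem condCov_of_mem {S : Matrix V V ℝ} (hS : S.PosDef) {K : Finset V} {a : V} (ha : a ∈ K)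
    (b : V) : condCov S K a b = 0 := by
  have hN : (S.submatrix (fun k : K => (k : V)) (fun k : K => (k : V))).PosDef :=
    hS.submatrix Subtype.val_injective
  have h : (condCov S K).submatrix (fun k : K => (k : V)) id = 0 := by
    have hu := (Matrix.isUnit_iff_isUnit_det _).1 hN.isUnit
    have : (condCov S K).submatrix (fun k : K => (k : V)) id =
        S.submatrix (fun k : K => (k : V)) id -
          S.submatrix (fun k : K => (k : V)) (fun k : K => (k : V)) *
          (S.submatrix (fun k : K => (k : V)) (fun k : K => (k : V)))⁻¹ *
          S.submatrix (fun k : K => (k : V)) id := by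
      ext x y
      simp [condCov, Matrix.mul_apply]
    rw [this, Matrix.mul_nonsing_inv _ hu, Matrix.one_mul, sub_self]
  exact congrFun (congrFun h ⟨a, ha⟩) b

theorem condCov_comm {S : Matrix V V ℝ} (hS : S.PosDef) (K : Finset V) (a b : V) :
    condCov S K a b = condCov S K b a := by
  have hT : Sᵀ = S := by simpa using hS.isHermitian.eq
  have : (condCov S K)ᵀ = condCov S K := by
    rw [condCov, Matrix.transpose_sub, Matrix.transpose_mul, Matrix.transpose_mul,
      Matrix.transpose_nonsing_inv]
    simp only [Matrix.transpose_submatrix, hT, Matrix.mul_assoc]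
  exact congrFun (congrFun this b) a

variable [Fintype V]

/-- `S⁻¹` maps the columns of `S` indexed by K to unit vectors, so the correction term contributes
only to rows in K. Together with vanishing on K this determines the columns, which avoids block
inversion later. -/
theorem inv_mulVec_condCov {S : Matrix V V ℝ} (hS : S.PosDef) {K : Finset V} {a : V} (ha : a ∉ K)
    (b : V) : (S⁻¹ *ᵥ (condCov S K).col b) a = (1 : Matrix V V ℝ) a b := by
  have hu := (Matrix.isUnit_iff_isUnit_det _).1 hS.isUnit
  have h1 : S.submatrix id (fun k : K => (k : V)) =
      S * (1 : Matrix V V ℝ).submatrix id (fun k : K => (k : V)) := by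
    ext x y
    simp [Matrix.mul_apply, Matrix.one_apply]
  have h2 : S⁻¹ * condCov S K = 1 - (1 : Matrix V V ℝ).submatrix id (fun k : K => (k : V)) *
      ((S.submatrix (fun k : K => (k : V)) (fun k : K => (k : V)))⁻¹ *
      S.submatrix (fun k : K => (k : V)) id) := by
    rw [condCov, h1, Matrix.mul_sub, Matrix.nonsing_inv_mul _ hu, Matrix.mul_assoc,
      Matrix.mul_assoc, ← Matrix.mul_assoc S⁻¹, Matrix.nonsing_inv_mul _ hu, Matrix.one_mul]
  have h3 : (S⁻¹ *ᵥ (condCov S K).col b) a = (S⁻¹ * condCov S K) a b := by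
    simp [Matrix.mul_apply, Matrix.mulVec, dotProduct, Matrix.col]
  rw [h3, h2, Matrix.sub_apply, Matrix.mul_apply, Finset.sum_eq_zero, sub_zero]
  intro x _
  have : a ≠ x := fun h => ha (h ▸ x.2)
  simp [this]

/-- A column of the conditional covariance matrix is determined by the precision matrix. -/
theorem eq_mul_condCov_of_inv_mulVec {S : Matrix V V ℝ} (hS : S.PosDef) {K : Finset V} {b : V}
    {w : V → ℝ} {r : ℝ} (h0 : ∀ a ∈ K, w a = 0)
    (h1 : ∀ a ∉ K, (S⁻¹ *ᵥ w) a = r * (1 : Matrix V V ℝ) a b) (a : V) :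
    w a = r * condCov S K a b := by
  by_contra hne
  have hd : w - r • (condCov S K).col b ≠ 0 := fun h => hne (sub_eq_zero.1 (congrFun h a))
  -- The difference vanishes on K and its image under `S⁻¹` vanishes off K, so the quadratic form of
  -- `S⁻¹` is zero at it.
  have := hS.inv.dotProduct_mulVec_pos hd
  refine this.ne' (Finset.sum_eq_zero fun x _ => ?_)
  by_cases hx : x ∈ K
  · simp [condCov_of_mem hS hx, h0 x hx, Matrix.col]
  · rw [Matrix.mulVec_sub, Pi.sub_apply, Matrix.mulVec_smul, Pi.smul_apply,
      inv_mulVec_condCov hS hx, h1 x hx, smul_eq_mul, sub_self, mul_zero]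

theorem condCov_self_pos {S : Matrix V V ℝ} (hS : S.PosDef) {K : Finset V} {b : V} (hb : b ∉ K) :
    0 < condCov S K b b := by
  have hne : (condCov S K).col b ≠ 0 := by
    intro h
    have := inv_mulVec_condCov hS hb b
    rw [h] at this
    simp at this
  have := hS.inv.dotProduct_mulVec_pos hne
  rw [dotProduct, Finset.sum_eq_single b] at this
  · rw [inv_mulVec_condCov hS hb] at this
    simpa [Matrix.col] using this
  · intro x _ hx
    by_cases hxK : x ∈ K
    · simp [condCov_of_mem hS hxK, Matrix.col]
    · rw [inv_mulVec_condCov hS hxK, Matrix.one_apply_ne hx, mul_zero]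
  · simp

/-- The multiple of column v is chosen to make the entry at v vanish; the combination then satisfies
the equations that characterize a column for the larger conditioning set. -/
theorem condCov_insert {S : Matrix V V ℝ} (hS : S.PosDef) {K : Finset V} {v b : V} (hv : v ∉ K)
    (hb : b ≠ v) (a : V) :
    condCov S (insert v K) a b =
      condCov S K a b - condCov S K a v * condCov S K v b / condCov S K v v := by
  have hvv := (condCov_self_pos hS hv).ne'
  have hw : (fun a => condCov S K a b - condCov S K a v * condCov S K v b / condCov S K v v) =
      (condCov S K).col b - (condCov S K v b / condCov S K v v) • (condCov S K).col v := by
    ext x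
    simp [Matrix.col]
    ring
  refine (one_mul _).symm.trans (eq_mul_condCov_of_inv_mulVec hS (w := fun a => condCov S K a b -
    condCov S K a v * condCov S K v b / condCov S K v v) ?_ ?_ a).symm
  · intro x hx
    rcases Finset.mem_insert.1 hx with rfl | hx
    · field_simp
      ring
    · simp [condCov_of_mem hS hx]
  · intro x hx
    rw [Finset.mem_insert, not_or] at hx
    rw [hw, Matrix.mulVec_sub, Matrix.mulVec_smul, Pi.sub_apply, Pi.smul_apply,
      inv_mulVec_condCov hS hx.2, inv_mulVec_condCov hS hx.2, Matrix.one_apply_ne hx.1]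
    simp

/-- This is positivity of the variance of b given a and K, expanded by `condCov_insert`. -/
theorem condCov_sq_le {S : Matrix V V ℝ} (hS : S.PosDef) {K : Finset V} {a b : V} (ha : a ∉ K)
    (hb : b ∉ K) (hab : a ≠ b) :
    condCov S K a b ^ 2 < condCov S K a a * condCov S K b b := by
  have h := condCov_self_pos hS (K := insert a K) (b := b) (by simp [hab.symm, hb])
  rw [condCov_insert hS ha hab.symm, condCov_comm hS K b a] at h
  have ha' := condCov_self_pos hS ha
  rw [sub_pos, div_lt_iff₀ ha'] at h
  nlinarith

/-- Conditional covariances and linear transformations of the unconditioned variables. -/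
theorem condCov_congr_mul {S T : Matrix V V ℝ} {K : Finset V}
    (hT : ∀ k ∈ K, ∀ a, T a k = (1 : Matrix V V ℝ) a k) :
    condCov (Tᵀ * S * T) K = Tᵀ * condCov S K * T := by
  have h1 : T.submatrix id (fun k : K => (k : V)) =
      (1 : Matrix V V ℝ).submatrix id (fun k : K => (k : V)) := by
    ext x y
    exact hT y y.2 x
  have h1' : Tᵀ.submatrix (fun k : K => (k : V)) id =
      (1 : Matrix V V ℝ).submatrix (fun k : K => (k : V)) id := by
    ext x y
    simpa [Matrix.one_apply, eq_comm] using hT x x.2 y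
  have h2 : (Tᵀ * S * T).submatrix id (fun k : K => (k : V)) =
      Tᵀ * S.submatrix id (fun k : K => (k : V)) := by
    rw [Matrix.submatrix_mul _ _ id id _ Function.bijective_id, h1, Matrix.submatrix_id_id]
    ext x y
    simp [Matrix.mul_apply, Matrix.one_apply]
  have h3 : (Tᵀ * S * T).submatrix (fun k : K => (k : V)) id =
      S.submatrix (fun k : K => (k : V)) id * T := by
    rw [Matrix.mul_assoc, Matrix.submatrix_mul _ _ _ id _ Function.bijective_id, h1']
    ext x y
    simp [Matrix.mul_apply, Matrix.one_apply]
  have h4 : (Tᵀ * S * T).submatrix (fun k : K => (k : V)) (fun k : K => (k : V)) =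
      S.submatrix (fun k : K => (k : V)) (fun k : K => (k : V)) := by
    ext x y
    have := congrFun (congrFun h3 x) y
    simp only [Matrix.submatrix_apply, id] at this ⊢
    rw [this, Matrix.mul_apply, Finset.sum_eq_single (y : V)]
    · simp [hT y y.2]
    · intro z _ hz
      simp [hT y y.2, hz]
    · simp
  rw [condCov, h2, h3, h4, condCov]
  simp only [Matrix.mul_sub, Matrix.sub_mul, Matrix.mul_assoc]

theorem partialCorr_sq {S : Matrix V V ℝ} (hS : S.PosDef) {K : Finset V} {a b : V} (ha : a ∉ K)
    (hb : b ∉ K) :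
    partialCorr S a b K ^ 2 = condCov S K a b ^ 2 / (condCov S K a a * condCov S K b b) := by
  rw [partialCorr, div_pow, mul_pow, Real.sq_sqrt (condCov_self_pos hS ha).le,
    Real.sq_sqrt (condCov_self_pos hS hb).le]

theorem abs_partialCorr_le_one {S : Matrix V V ℝ} (hS : S.PosDef) {K : Finset V} {a b : V}
    (ha : a ∉ K) (hb : b ∉ K) (hab : a ≠ b) : |partialCorr S a b K| ≤ 1 := by
  rw [abs_le_one_iff_mul_self_le_one, ← pow_two, partialCorr_sq hS ha hb,
    div_le_one (mul_pos (condCov_self_pos hS ha) (condCov_self_pos hS hb))]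
  exact (condCov_sq_le hS ha hb hab).le

/-- Partial correlations are multiplicative along a conditional independence. -/
theorem partialCorr_eq_mul {S : Matrix V V ℝ} (hS : S.PosDef) {K : Finset V} {i j l : V}
    (hj : j ∉ K) (hjl : j ≠ l) (h : condCov S (insert j K) i l = 0) :
    partialCorr S i l K = partialCorr S i j K * partialCorr S j l K := by
  have hjj := condCov_self_pos hS hj
  rw [condCov_insert hS hj hjl.symm, sub_eq_zero] at h
  rw [partialCorr, h, partialCorr, partialCorr]
  have hs := Real.sqrt_pos.2 hjj
  have hm := Real.mul_self_sqrt hjj.le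
  set r := √(condCov S K j j)
  rw [← hm]
  field_simp

end CondCov

/-! ### The scalar inequality behind the counterexample -/

section Perturbation

open Filter Topology

theorem exists_lt_of_continuous {f g : ℝ → ℝ} (hf : Continuous f) (hg : Continuous g)
    (h : f 0 < g 0) : ∃ δ > 0, ∀ s, 0 < s → s < δ → f s < g s := by
  have := (hf.continuousAt (x := 0)).eventually_lt hg.continuousAt h
  obtain ⟨δ, hδ, H⟩ := Metric.eventually_nhds_iff.1 this
  exact ⟨δ, hδ, fun s hs hs' => H (by rwa [Real.dist_eq, sub_zero, abs_of_pos hs])⟩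

theorem exists_affine_pos {a : ℝ} (ha : a ≠ 0) (b : ℝ) : ∃ t : ℝ, t ≠ 0 ∧ 0 < a * t + b := by
  have h : |b| + 1 ≠ 0 := by positivity
  refine ⟨(|b| + 1) / a, div_ne_zero h ha, ?_⟩
  rw [mul_div_cancel₀ _ ha]
  linarith [neg_abs_le b]

/-- The perturbation inequality: the conclusion compares the (unnormalized) conditional
covariances after scaling the weights into a vertex by `t` and setting its variance to `w`. -/
theorem exists_perturbation {p q iy ly Y zi zl g d w₀ : ℝ} (hd : 0 ≤ d) (hY : 0 ≤ Y)
    (h1 : p * ((1 - g) ^ 2 + d * (Y + w₀)) + zi * zl * (Y + w₀) + (1 - g) * (zi * ly + zl * iy) -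
      d * iy * ly ≠ 0) (h2 : p * (Y + w₀) ≠ iy * ly) :
    ∃ t w k W N : ℝ, 0 < w ∧ k = 1 - t * g ∧ W = t ^ 2 * Y + w ∧ N = k ^ 2 + d * W ∧
      (zi * W + k * t * iy) ^ 2 *
        (q * N + zl ^ 2 * W + 2 * k * t * (zl * ly) - d * t ^ 2 * ly ^ 2) <
      (p * N + zi * zl * W + k * t * (zi * ly + zl * iy) - d * t ^ 2 * iy * ly) ^ 2 * W := by
  rcases eq_or_ne p 0 with rfl | hp
  · have hy : iy * ly ≠ 0 := fun h => h2 (by rw [h, zero_mul])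
    have hiy := left_ne_zero_of_mul hy
    have hly := right_ne_zero_of_mul hy
    rcases eq_or_ne zi 0 with rfl | hzi
    · rcases hd.eq_or_lt with rfl | hd
      · have hzl : zl ≠ 0 := by
          rintro rfl
          simp at h1
        -- With p, zi and d zero, N = k² and the terms in W cancel. What remains is k (q k + 2 t zl
        -- ly) < 0.
        obtain ⟨t, ht, hk, hneg⟩ : ∃ t : ℝ, t ≠ 0 ∧ 1 - t * g ≠ 0 ∧
            (1 - t * g) * (q * (1 - t * g) + 2 * t * (zl * ly)) < 0 := by
          rcases eq_or_ne g 0 with rfl | hg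
          · obtain ⟨t, ht, h⟩ := exists_affine_pos (a := -(2 * (zl * ly)))
              (neg_ne_zero.2 (by positivity)) (-q)
            exact ⟨t, ht, by simp, by nlinarith⟩
          · set s := zl * ly / g with hs
            have hs0 : s ≠ 0 := by positivity
            obtain ⟨δ, hδ, H⟩ := exists_lt_of_continuous (f := fun _ => (0 : ℝ))
              (g := fun x => min (1 + x * s) (2 + 2 * x * s - q * x)) (by fun_prop) (by fun_prop)
              (by simp)
            have := H (δ / 2) (by positivity) (by linarith)
            set x := δ / 2 with hx
            have hx0 : 0 < x := by positivity
            rw [lt_min_iff] at this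
            -- Moving t slightly off 1/g gives k = -x s, with the sign opposite to that of zl ly /
            -- g.
            refine ⟨(1 + x * s) / g, div_ne_zero this.1.ne' hg, ?_, ?_⟩
            · rw [div_mul_cancel₀ _ hg]
              simpa using ⟨hx0.ne', hs0⟩
            · have e : (1 - (1 + x * s) / g * g) *
                  (q * (1 - (1 + x * s) / g * g) + 2 * ((1 + x * s) / g) * (zl * ly)) =
                  -(x * s ^ 2 * (2 + 2 * x * s - q * x)) := by
                rw [div_mul_cancel₀ _ hg, hs]
                field_simp
                ring
              rw [e, neg_lt_zero]
              have := this.2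
              positivity
        refine ⟨t, 1, _, _, _, one_pos, rfl, rfl, rfl, ?_⟩
        have : 0 < (t * iy) ^ 2 * (1 - t * g) ^ 2 := by positivity
        nlinarith [mul_pos_of_neg_of_neg (neg_lt_zero.2 this) hneg]
      · rcases eq_or_ne g 0 with rfl | hg
        -- Here k = 1, and the difference of the two sides divided by (t iy)² is affine in W. A
        -- large t makes its slope positive; then a large w suffices.
        · obtain ⟨t, ht, hα⟩ : ∃ t : ℝ, t ≠ 0 ∧
              0 < d * t ^ 2 * ly ^ 2 - 2 * t * zl * ly - q := by
            have hc : 0 < d * ly ^ 2 := by positivity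
            refine ⟨(1 + 2 * |zl * ly| + |q|) * (1 + 1 / (d * ly ^ 2)), by positivity, ?_⟩
            set m := 1 + 2 * |zl * ly| + |q| with hm
            set r := 1 / (d * ly ^ 2) with hr
            have hr0 : 0 < r := by positivity
            have hcr : d * ly ^ 2 * r = 1 := by rw [hr]; field_simp
            have hm1 : 1 ≤ m := by rw [hm]; linarith [abs_nonneg (zl * ly), abs_nonneg q]
            have e : d * (m * (1 + r)) ^ 2 * ly ^ 2 =
                m * (m * (1 + r)) * (d * ly ^ 2 + d * ly ^ 2 * r) := by ring
            rw [e, hcr]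
            have hT : 1 ≤ m * (1 + r) := by nlinarith
            set T := m * (1 + r)
            have h3 : m * T ≤ m * T * (d * ly ^ 2 + 1) := by
              have : 0 < m * T := by positivity
              nlinarith
            have h4 : (zl * ly) * T ≤ |zl * ly| * T := by
              gcongr
              exact le_abs_self _
            have h5 : |q| ≤ |q| * T := by nlinarith [abs_nonneg q]
            have h6 : m * T = T + 2 * (|zl * ly| * T) + |q| * T := by rw [hm]; ring
            linarith [le_abs_self q]
          obtain ⟨w, hw0, hw⟩ : ∃ w : ℝ, 0 < w ∧
              0 < d * (d * t ^ 2 * ly ^ 2 - 2 * t * zl * ly - q) * w +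
                (d * (d * t ^ 2 * ly ^ 2 - 2 * t * zl * ly - q) * (t ^ 2 * Y) -
                  (q + 2 * t * zl * ly - d * t ^ 2 * ly ^ 2)) := by
            have ha := mul_pos hd hα
            set α := d * (d * t ^ 2 * ly ^ 2 - 2 * t * zl * ly - q)
            set β := α * (t ^ 2 * Y) - (q + 2 * t * zl * ly - d * t ^ 2 * ly ^ 2)
            refine ⟨(|β| + 1) / α, by positivity, ?_⟩
            rw [mul_div_cancel₀ _ ha.ne']
            linarith [neg_abs_le β]
          refine ⟨t, w, _, _, _, hw0, rfl, rfl, rfl, ?_⟩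
          have : 0 < (t * iy) ^ 2 := by positivity
          rw [← sub_pos]
          refine lt_of_lt_of_eq (mul_pos this hw) ?_
          ring
        -- At t = 1/g, k vanishes and with it the covariance of i and j, while the term d t² iy ly
        -- survives.
        · refine ⟨1 / g, 1, _, _, _, one_pos, rfl, rfl, rfl, ?_⟩
          have hk : 1 - 1 / g * g = 0 := by rw [one_div_mul_cancel hg, sub_self]
          rw [hk]
          have : 0 < (1 / g) ^ 2 * Y + 1 := by positivity
          have hsq : 0 < (d * (1 / g) ^ 2 * iy * ly) ^ 2 := by positivity
          refine lt_of_eq_of_lt (b := 0) (by ring) ?_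
          refine lt_of_lt_of_eq (mul_pos hsq this) ?_
          ring
    -- The curve t = -s zi iy, W = s iy² k solves zi W + k t iy = 0, so i and j become uncorrelated
    -- given K. For small s > 0 both k and the variance w = W - t² Y are positive.
    · obtain ⟨δ, hδ, H⟩ := exists_lt_of_continuous (f := fun _ => (0 : ℝ))
        (g := fun s => min (1 + s * (zi * iy * g)) (1 + s * (zi * iy * g) - s * (zi ^ 2 * Y)))
        (by fun_prop) (by fun_prop) (by simp)
      have := H (δ / 2) (by positivity) (by linarith)
      set s := δ / 2
      have hs0 : 0 < s := by positivity
      rw [lt_min_iff] at this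
      obtain ⟨hk, hw⟩ := this
      have hw' : 0 < s * iy ^ 2 * (1 + s * (zi * iy * g) - s * (zi ^ 2 * Y)) := by positivity
      refine ⟨-(s * zi * iy), s * iy ^ 2 * (1 + s * (zi * iy * g) - s * (zi ^ 2 * Y)),
        1 + s * (zi * iy * g), s * iy ^ 2 * (1 + s * (zi * iy * g)), _, hw', by ring, by ring, rfl, ?_⟩
      refine lt_of_eq_of_lt (b := 0) (by ring) ?_
      have h3 : 0 < 1 + s * (zi * iy * g) + d * s * iy ^ 2 := by positivity
      have h4 : 0 < (s * zi * iy * ly * zi * (1 + s * (zi * iy * g) + d * s * iy ^ 2)) ^ 2 := by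
        positivity
      refine lt_of_lt_of_eq (mul_pos h4 (b := s * iy ^ 2 * (1 + s * (zi * iy * g)))
        (by positivity)) ?_
      ring
  -- Cutting all edges into j (t = 0) and dividing by w leaves an inequality that becomes 0 < p² as
  -- w tends to 0.
  · obtain ⟨δ, hδ, H⟩ := exists_lt_of_continuous
      (f := fun w => zi ^ 2 * w * (q * (1 + d * w) + zl ^ 2 * w))
      (g := fun w => (p * (1 + d * w) + zi * zl * w) ^ 2) (by fun_prop) (by fun_prop)
      (by simp; positivity)
    have := H (δ / 2) (by positivity) (by linarith)
    set w := δ / 2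
    have hw : 0 < w := by positivity
    refine ⟨0, w, 1, w, 1 + d * w, hw, by ring, by ring, by ring, ?_⟩
    have := mul_lt_mul_of_pos_right this hw
    refine lt_of_eq_of_lt ?_ (lt_of_lt_of_eq this ?_) <;> ring

end Perturbation

/-! ### Changing the mechanism of one vertex -/

section Model

open Matrix

variable {V : Type*} [Fintype V] [DecidableEq V]

theorem IsDAG.wellFounded {V : Type*} [Finite V] {G : Digraph V} (hG : IsDAG G) :
    WellFounded (fun v u => Relation.TransGen G.Adj u v) := by
  have : Std.Irrefl (fun v u => Relation.TransGen G.Adj u v) := ⟨hG⟩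
  have : IsTrans V (fun v u => Relation.TransGen G.Adj u v) := ⟨fun _ _ _ h h' => h'.trans h⟩
  exact Finite.wellFounded_of_trans_of_irrefl _

/-- A kernel vector satisfies x_u = ∑ λ_{uv} x_v, hence vanishes by induction starting at the sinks.
-/
theorem isUnit_one_sub {G : Digraph V} (hG : IsDAG G) {L : Matrix V V ℝ}
    (hL : L ∈ edgeWeights G) : IsUnit (1 - L) := by
  rw [← Matrix.mulVec_injective_iff_isUnit]
  refine (injective_iff_map_eq_zero (1 - L).mulVecLin).2 fun x hx => ?_
  rw [Matrix.mulVecLin_apply, Matrix.sub_mulVec, Matrix.one_mulVec, sub_eq_zero] at hx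
  funext u
  induction u using hG.wellFounded.induction with
  | _ u ih =>
    rw [hx]
    refine Finset.sum_eq_zero fun v _ => ?_
    by_cases h : G.Adj u v
    · rw [ih v (.single h), Pi.zero_apply, mul_zero]
    · exact mul_eq_zero_of_left (hL u v h) _

theorem semCov_posDef {L : Matrix V V ℝ} (hL : IsUnit (1 - L)) {w : V → ℝ} (hw : ∀ v, 0 < w v) :
    (semCov (L, w)).PosDef := by
  have h : (diagonal w).PosDef := Matrix.PosDef.diagonal hw
  have := h.conjTranspose_mul_mul_same (B := (1 - L)⁻¹)
    (Matrix.mulVec_injective_iff_isUnit.2 (by simpa using hL))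
  simpa [semCov] using this

theorem semCov_inv {L : Matrix V V ℝ} (hL : IsUnit (1 - L)) {w : V → ℝ} (hw : ∀ v, 0 < w v) :
    (semCov (L, w))⁻¹ = (1 - L) * diagonal w⁻¹ * (1 - L)ᵀ := by
  have hu := (Matrix.isUnit_iff_isUnit_det _).1 hL
  have hd : (diagonal w) * diagonal w⁻¹ = 1 := by
    rw [Matrix.diagonal_mul_diagonal, ← Matrix.diagonal_one]
    congr
    funext v
    simp [(hw v).ne']
  apply Matrix.inv_eq_right_inv
  calc ((1 - L)⁻¹)ᵀ * diagonal w * (1 - L)⁻¹ * ((1 - L) * diagonal w⁻¹ * (1 - L)ᵀ)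
      = ((1 - L)⁻¹)ᵀ * (diagonal w * ((1 - L)⁻¹ * (1 - L)) * diagonal w⁻¹) * (1 - L)ᵀ := by
        simp only [Matrix.mul_assoc]
    _ = 1 := by
        rw [Matrix.nonsing_inv_mul _ hu, Matrix.mul_one, hd, Matrix.mul_one,
          ← Matrix.transpose_mul, Matrix.mul_nonsing_inv _ hu, Matrix.transpose_one]

/-- The precision matrix is ∑ ω_v⁻¹ c_v c_vᵀ with c_v the columns of I - Λ, so the mechanism of a
vertex enters through one rank-one term. -/
theorem semCov_inv_mulVec {L : Matrix V V ℝ} (hL : IsUnit (1 - L)) {w : V → ℝ}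
    (hw : ∀ v, 0 < w v) (x : V → ℝ) (a : V) :
    ((semCov (L, w))⁻¹ *ᵥ x) a =
      ∑ v, (w v)⁻¹ * ((1 - L).col v ⬝ᵥ x) * (1 - L).col v a := by
  rw [semCov_inv hL hw, Matrix.mul_assoc, ← Matrix.mulVec_mulVec, ← Matrix.mulVec_mulVec]
  simp only [Matrix.mulVec, dotProduct, Matrix.diagonal_apply, Matrix.transpose_apply,
    Matrix.col_apply, Pi.inv_apply]
  refine Finset.sum_congr rfl fun v _ => ?_
  rw [Finset.sum_eq_single v (fun u _ hu => by simp [hu.symm]) (by simp)]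
  simp
  ring

/-- In the reference model j has no parents and variance 1; its term e_j e_jᵀ is exchanged for ω⁻¹
(e_j - y)(e_j - y)ᵀ. -/
theorem semCov_update_inv_mulVec {L : Matrix V V ℝ} {w : V → ℝ} (hw : ∀ v, 0 < w v) {j : V}
    {y : V → ℝ} {ω : ℝ} (hω : 0 < ω) (h0 : IsUnit (1 - L.updateCol j 0))
    (hy : IsUnit (1 - L.updateCol j y)) (x : V → ℝ) (a : V) :
    ((semCov (L.updateCol j y, Function.update w j ω))⁻¹ *ᵥ x) a =
      ((semCov (L.updateCol j 0, Function.update w j 1))⁻¹ *ᵥ x) a +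
        ω⁻¹ * (x j - y ⬝ᵥ x) * ((1 : Matrix V V ℝ) a j - y a) - x j * (1 : Matrix V V ℝ) a j := by
  have hw1 : ∀ v, 0 < Function.update w j 1 v := fun v => by
    by_cases h : v = j <;> simp [h, hw]
  have hw2 : ∀ v, 0 < Function.update w j ω v := fun v => by
    by_cases h : v = j <;> simp [h, hw, hω]
  have hc : ∀ z : V → ℝ, (1 - L.updateCol j z).col j = Pi.single j 1 - z := fun z => by
    ext b
    simp [Matrix.col, Matrix.one_apply, Pi.single_apply]
  have hv : ∀ z : V → ℝ, ∀ v ≠ j, (1 - L.updateCol j z).col v = (1 - L).col v := fun z v h => by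
    ext b
    simp [Matrix.col, h]
  rw [semCov_inv_mulVec hy hw2, semCov_inv_mulVec h0 hw1, ← Finset.add_sum_erase _ _
    (Finset.mem_univ j), ← Finset.add_sum_erase _ _ (Finset.mem_univ j)]
  have hs : ∑ v ∈ Finset.univ.erase j, (Function.update w j ω v)⁻¹ *
        ((1 - L.updateCol j y).col v ⬝ᵥ x) * (1 - L.updateCol j y).col v a =
      ∑ v ∈ Finset.univ.erase j, (Function.update w j 1 v)⁻¹ *
        ((1 - L.updateCol j 0).col v ⬝ᵥ x) * (1 - L.updateCol j 0).col v a := by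
    refine Finset.sum_congr rfl fun v h => ?_
    have h := Finset.ne_of_mem_erase h
    rw [hv _ v h, hv _ v h, Function.update_of_ne h, Function.update_of_ne h]
  rw [hs, hc, hc]
  simp [Matrix.one_apply, Pi.single_apply, sub_dotProduct]
  ring

/-- Conditional covariances after replacing the weights of the edges into `j` by `t` times those
of a fixed vector `y`, and the error variance of `j` by `ω`. -/
theorem exists_condCov_update {G : Digraph V} (hG : IsDAG G) {L : Matrix V V ℝ}
    (hL : L ∈ edgeWeights G) {w : V → ℝ} (hw : ∀ v, 0 < w v) {K : Finset V} {j : V} (hj : j ∉ K) :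
    ∃ (B : V → V → ℝ) (z u : V → ℝ) (d g Y : ℝ), 0 ≤ d ∧ 0 ≤ Y ∧ z j = 1 ∧ u j = 0 ∧
      (∀ b, B j b = 0) ∧ (∀ a, B a j = 0) ∧
      ∀ t ω k W N : ℝ, 0 < ω → k = 1 - t * g → W = t ^ 2 * Y + ω → N = k ^ 2 + d * W →
        ∀ b ∉ K, ∀ a, B a b * N + z a * z b * W + k * t * (z a * u b + z b * u a) -
            d * t ^ 2 * u a * u b =
          N * condCov (semCov (L.updateCol j (t • L.col j), Function.update w j ω)) K a b := by
  have hmem : ∀ t : ℝ, L.updateCol j (t • L.col j) ∈ edgeWeights G := fun t a b hab => by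
    by_cases h : b = j
    · subst h
      simp [hL a b hab]
    · simp [h, hL a b hab]
  have hun : ∀ t : ℝ, IsUnit (1 - L.updateCol j (t • L.col j)) := fun t =>
    isUnit_one_sub hG (hmem t)
  have h0 : IsUnit (1 - L.updateCol j 0) := by simpa using hun 0
  have hup : ∀ ω : ℝ, 0 < ω → ∀ v, 0 < Function.update w j ω v := fun ω hω v => by
    by_cases h : v = j <;> simp [h, hw, hω]
  set S := semCov (L.updateCol j 0, Function.update w j 1) with hS
  have hSp : S.PosDef := semCov_posDef h0 (hup 1 one_pos)
  have hcjj := condCov_self_pos hSp hj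
  set c := condCov S K with hc
  set y := L.col j with hy
  -- In the reference model, `z` holds the regression coefficients on j given K, `B` is the
  -- conditional covariance given K and j, and `u` is the image under `B` of the weights into j.
  set z : V → ℝ := fun a => c a j / c j j with hz
  set B : Matrix V V ℝ := fun a b => c a b - c a j * c j b / c j j with hB
  set u := B *ᵥ y with hu
  have hzj : z j = 1 := div_self hcjj.ne'
  have hzK : ∀ a ∈ K, z a = 0 := fun a ha => by simp [hz, hc, condCov_of_mem hSp ha]
  have hBK : ∀ a ∈ K, ∀ b, B a b = 0 := fun a ha b => by simp [hB, hc, condCov_of_mem hSp ha]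
  have hBs : ∀ a b, B a b = B b a := fun a b => by
    simp only [hB, hc]
    rw [condCov_comm hSp K a b, condCov_comm hSp K a j, condCov_comm hSp K j b]
    ring
  have hBj : ∀ b, B j b = 0 := fun b => by
    simp only [hB]
    field_simp
    ring
  have hBp : ∀ b ∉ K, ∀ a ∉ K, (S⁻¹ *ᵥ B.col b) a =
      (1 : Matrix V V ℝ) a b - z b * (1 : Matrix V V ℝ) a j := fun b hb a ha => by
    have : B.col b = c.col b - z b • c.col j := by
      ext x
      change c x b - c x j * c j b / c j j = c x b - c b j / c j j * c x j
      rw [hc, condCov_comm hSp K j b]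
      ring
    rw [this, Matrix.mulVec_sub, Matrix.mulVec_smul, Pi.sub_apply, Pi.smul_apply,
      inv_mulVec_condCov hSp ha, inv_mulVec_condCov hSp ha, smul_eq_mul]
  have hzp : ∀ a ∉ K, (S⁻¹ *ᵥ z) a = (c j j)⁻¹ * (1 : Matrix V V ℝ) a j := fun a ha => by
    have : z = (c j j)⁻¹ • c.col j := by
      ext x
      simp only [Matrix.col_apply, hz, Pi.smul_apply, smul_eq_mul]
      ring
    rw [this, Matrix.mulVec_smul, Pi.smul_apply, inv_mulVec_condCov hSp ha, smul_eq_mul]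
  have hup' : ∀ a ∉ K, (S⁻¹ *ᵥ u) a = y a - (y ⬝ᵥ z) * (1 : Matrix V V ℝ) a j := fun a ha => by
    have : u = ∑ b, y b • B.col b := by
      ext x
      simp [hu, Matrix.mulVec, dotProduct, Finset.sum_apply, mul_comm]
    rw [this, Matrix.mulVec_sum, Finset.sum_apply]
    have e : ∀ b, (S⁻¹ *ᵥ (y b • B.col b)) a =
        y b * (1 : Matrix V V ℝ) a b - y b * z b * (1 : Matrix V V ℝ) a j := fun b => by
      rw [Matrix.mulVec_smul, Pi.smul_apply, smul_eq_mul]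
      by_cases hb : b ∈ K
      · have h1 : B.col b = 0 := by
          ext x
          rw [Matrix.col_apply, hBs, hBK b hb, Pi.zero_apply]
        have h2 : a ≠ b := fun h => ha (h ▸ hb)
        simp [h1, h2, hzK b hb]
      · rw [hBp b hb a ha]
        ring
    simp only [e, Finset.sum_sub_distrib, ← Finset.sum_mul, dotProduct]
    congr 1
    simp [Matrix.one_apply]
  have huj : u j = 0 := by simp [hu, Matrix.mulVec, dotProduct, hBj]
  have huK : ∀ a ∈ K, u a = 0 := fun a ha => by simp [hu, Matrix.mulVec, dotProduct, hBK a ha]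
  have hyB : ∀ b, y ⬝ᵥ B.col b = u b := fun b => by
    simp only [hu, Matrix.mulVec, dotProduct, Matrix.col_apply]
    exact Finset.sum_congr rfl fun x _ => by rw [hBs, mul_comm]
  have hY : 0 ≤ y ⬝ᵥ u := by
    have h1 : y ⬝ᵥ u = u ⬝ᵥ (S⁻¹ *ᵥ u) := by
      refine Finset.sum_congr rfl fun a _ => ?_
      by_cases ha : a ∈ K
      · simp [huK a ha]
      · rw [hup' a ha]
        by_cases haj : a = j
        · subst haj
          simp [huj]
        · simp [haj, mul_comm]
    rw [h1]
    simpa using hSp.inv.posSemidef.dotProduct_mulVec_nonneg u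
  -- The quadratic form of the reference precision matrix at `z` equals 1/c_jj; it is a sum of
  -- nonnegative terms, of which the one for j is 1.
  have hd : 1 ≤ (c j j)⁻¹ := by
    have h1 : z ⬝ᵥ (S⁻¹ *ᵥ z) = (c j j)⁻¹ := by
      rw [dotProduct, Finset.sum_eq_single j]
      · rw [hzp j hj, hzj]
        simp
      · intro a _ haj
        by_cases ha : a ∈ K
        · simp [hzK a ha]
        · rw [hzp a ha]
          simp [haj]
      · simp
    have h2 : z ⬝ᵥ (S⁻¹ *ᵥ z) = ∑ v, (Function.update w j 1 v)⁻¹ *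
        ((1 - L.updateCol j 0).col v ⬝ᵥ z) ^ 2 := by
      simp only [dotProduct, hS, semCov_inv_mulVec h0 (hup 1 one_pos), Finset.mul_sum]
      rw [Finset.sum_comm]
      refine Finset.sum_congr rfl fun v _ => ?_
      rw [← Finset.mul_sum, pow_two, ← mul_assoc, Finset.mul_sum _ _
        (_ * ∑ i, (1 - L.updateCol j 0).col v i * z i)]
      exact Finset.sum_congr rfl fun x _ => by ring
    rw [← h1, h2]
    refine le_trans ?_ (Finset.single_le_sum (fun v _ => ?_) (Finset.mem_univ j))
    · have : (1 - L.updateCol j 0).col j = Pi.single j 1 := by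
        ext b
        simp [Matrix.col, Matrix.one_apply, Pi.single_apply]
      rw [this]
      simp [hzj]
    · exact mul_nonneg (inv_nonneg.2 (hup 1 one_pos v).le) (sq_nonneg _)
  refine ⟨B, z, u, (c j j)⁻¹ - 1, y ⬝ᵥ z, y ⬝ᵥ u, sub_nonneg.2 hd, hY, hzj, huj, hBj,
    fun a => by rw [hBs, hBj], ?_⟩
  intro t ω k W N hω hk hW hN b hb a
  set d := (c j j)⁻¹ - 1 with hdd
  -- On `B.col b`, `z` and `u` the reference precision matrix yields, off K, only multiples of e_b,
  -- e_j and y. The coefficients make the e_j and y parts cancel after the rank-one exchange.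
  set x : V → ℝ := N • B.col b + (z b * W + k * t * u b) • z +
    (k * t * z b - d * t ^ 2 * u b) • u with hx
  have hxa : ∀ a, x a = B a b * N + z a * z b * W + k * t * (z a * u b + z b * u a) -
      d * t ^ 2 * u a * u b := fun a => by
    simp only [hx, Pi.add_apply, Pi.smul_apply, smul_eq_mul, Matrix.col_apply]
    ring
  rw [← hxa]
  refine eq_mul_condCov_of_inv_mulVec (semCov_posDef (hun t) (hup ω hω)) ?_ ?_ a
  · intro a ha
    rw [hxa, hBK a ha, hzK a ha, huK a ha]
    simp
  · intro a ha
    rw [semCov_update_inv_mulVec hw hω h0 (hun t), ← hS, smul_dotProduct]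
    have hxj : x j = z b * W + k * t * u b := by
      rw [hxa, hBj, hzj, huj]
      ring
    have hyx : y ⬝ᵥ x = N * u b + (z b * W + k * t * u b) * (y ⬝ᵥ z) +
        (k * t * z b - d * t ^ 2 * u b) * (y ⬝ᵥ u) := by
      rw [hx, dotProduct_add, dotProduct_add, dotProduct_smul, dotProduct_smul, dotProduct_smul,
        hyB, smul_eq_mul, smul_eq_mul, smul_eq_mul]
    have hSx : (S⁻¹ *ᵥ x) a =
        N * ((1 : Matrix V V ℝ) a b - z b * (1 : Matrix V V ℝ) a j) +
        (z b * W + k * t * u b) * ((d + 1) * (1 : Matrix V V ℝ) a j) +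
        (k * t * z b - d * t ^ 2 * u b) * (y a - (y ⬝ᵥ z) * (1 : Matrix V V ℝ) a j) := by
      rw [hx, Matrix.mulVec_add, Matrix.mulVec_add, Matrix.mulVec_smul, Matrix.mulVec_smul,
        Matrix.mulVec_smul, Pi.add_apply, Pi.add_apply, Pi.smul_apply, Pi.smul_apply,
        Pi.smul_apply, hBp b hb a ha, hzp a ha, hup' a ha, smul_eq_mul, smul_eq_mul, smul_eq_mul,
        hdd, sub_add_cancel]
    -- With N = k² + d W the bracket factors as (W - t² Y)(k z_b - d t u_b), and W - t² Y = ω.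
    have hr : ω⁻¹ * (x j - t * (y ⬝ᵥ x)) = k * z b - d * t * u b := by
      rw [hxj, hyx]
      field_simp
      rw [hN, hk, hW]
      ring
    rw [smul_eq_mul, hr, hSx, hxj, Pi.smul_apply, smul_eq_mul, hN, hk]
    ring

/-- If neither `j` and `K` together nor `K` alone render `i` and `l` independent, the partial
correlation of `i` and `l` given `K` may exceed that of `i` and `j`. -/
theorem exists_abs_partialCorr_lt {G : Digraph V} (hG : IsDAG G) {L : Matrix V V ℝ}
    (hL : L ∈ edgeWeights G) {w : V → ℝ} (hw : ∀ v, 0 < w v) {K : Finset V} {i j l : V}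
    (hi : i ∉ K) (hj : j ∉ K) (hl : l ∉ K) (hjl : j ≠ l)
    (h1 : condCov (semCov (L, w)) K i l ≠ 0)
    (h2 : condCov (semCov (L, w)) (insert j K) i l ≠ 0) :
    ∃ S ∈ dagModel G, S.PosDef ∧ |partialCorr S i j K| < |partialCorr S i l K| := by
  obtain ⟨B, z, u, d, g, Y, hd, hY, hzj, huj, hBj, hBj', H⟩ := exists_condCov_update hG hL hw hj
  have hSp := semCov_posDef (isUnit_one_sub hG hL) hw
  set S := semCov (L, w) with hS
  have hself : semCov (L.updateCol j ((1 : ℝ) • L.col j), Function.update w j (w j)) = S := by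
    have : L.updateCol j (L.col j) = L := by
      ext a b
      by_cases h : b = j
      · subst h
        simp
      · simp [h]
    rw [Function.update_eq_self, one_smul, this]
  -- t = 1 and ω = w j give back the original matrix, so the two nonvanishing hypotheses become
  -- conditions on `B`, `z` and `u`.
  have H1 := H 1 (w j) _ _ _ (hw j) rfl rfl rfl
  rw [hself] at H1
  set k := 1 - 1 * g with hk
  set W := 1 ^ 2 * Y + w j with hW
  set N := k ^ 2 + d * W with hN
  have hWp : 0 < W := by
    have := hw j
    positivity
  have hjj := H1 j hj j
  have hij := H1 j hj i
  have hjl' := H1 l hl j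
  have hil := H1 l hl i
  rw [hBj, hzj, huj] at hjj
  rw [hBj', hzj, huj] at hij
  rw [hBj, hzj, huj] at hjl'
  have hNp : 0 < N := pos_of_mul_pos_left (b := condCov S K j j)
    (by rw [← hjj]; linarith) (condCov_self_pos hSp hj).le
  have hne1 : B i l * ((1 - g) ^ 2 + d * (Y + w j)) + z i * z l * (Y + w j) +
      (1 - g) * (z i * u l + z l * u i) - d * u i * u l ≠ 0 := by
    refine ne_of_eq_of_ne ?_ (mul_ne_zero hNp.ne' h1)
    rw [← hil, hN, hW, hk]
    ring
  -- At t = 1, N² (σ_il σ_jj - σ_ij σ_jl) = N (B_il W - u_i u_l), all given K.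
  have hne2 : B i l * (Y + w j) ≠ u i * u l := by
    intro h
    refine h2 ?_
    rw [condCov_insert hSp hj hjl.symm, sub_eq_zero, eq_div_iff (condCov_self_pos hSp hj).ne']
    refine mul_left_cancel₀ (mul_pos hNp hNp).ne' ?_
    have e : ∀ x y, N * N * (x * y) = (N * x) * (N * y) := fun x y => by ring
    rw [e, e, ← hil, ← hjj, ← hij, ← hjl']
    have h' : B i l * W = u i * u l := by rw [← h, hW]; ring
    linear_combination N * h' + hN * (u i * u l)
  obtain ⟨t, ω, k', W', N', hω, hk', hW', hN', hlt⟩ :=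
    exists_perturbation (p := B i l) (q := B l l) (iy := u i) (ly := u l) (Y := Y) (zi := z i)
      (zl := z l) (g := g) (d := d) (w₀ := w j) hd hY hne1 hne2
  · have hmem : L.updateCol j (t • L.col j) ∈ edgeWeights G := fun a b hab => by
      by_cases h : b = j
      · subst h
        simp [hL a b hab]
      · simp [h, hL a b hab]
    have hw' : ∀ v, 0 < Function.update w j ω v := fun v => by
      by_cases h : v = j <;> simp [h, hw, hω]
    have hT := semCov_posDef (isUnit_one_sub hG hmem) hw'
    have H2 := H t ω k' W' N' hω hk' hW' hN'
    refine ⟨_, ⟨(_, _), ⟨hmem, hw'⟩, rfl⟩, hT, ?_⟩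
    set T := semCov (L.updateCol j (t • L.col j), Function.update w j ω)
    have hjj := H2 j hj j
    have hij := H2 j hj i
    have hll := H2 l hl l
    have hil := H2 l hl i
    rw [hBj, hzj, huj] at hjj
    rw [hBj', hzj, huj] at hij
    have e1 : z i * W' + k' * t * u i = N' * condCov T K i j := by rw [← hij]; ring
    have e2 : W' = N' * condCov T K j j := by rw [← hjj]; ring
    have e3 : B l l * N' + z l ^ 2 * W' + 2 * k' * t * (z l * u l) - d * t ^ 2 * u l ^ 2 =
        N' * condCov T K l l := by rw [← hll]; ring
    rw [e1, e3, hil] at hlt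
    rw [e2] at hlt
    have hi' := condCov_self_pos hT hi
    have hj' := condCov_self_pos hT hj
    have hl' := condCov_self_pos hT hl
    have hW'p : 0 < W' := by rw [hW']; positivity
    have hN'p : 0 < N' := pos_of_mul_pos_left (e2 ▸ hW'p) hj'.le
    change |partialCorr T i j K| < |partialCorr T i l K|
    rw [← sq_lt_sq, partialCorr_sq hT hi hj, partialCorr_sq hT hi hl, div_lt_div_iff₀
      (by positivity) (by positivity)]
    have : 0 < N' ^ 3 := by positivity
    refine lt_of_mul_lt_mul_left ?_ this.le
    have := mul_lt_mul_of_pos_right hlt hi'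
    refine lt_of_eq_of_lt ?_ (lt_of_lt_of_eq this ?_) <;> ring

end Model

/-! ### d-separation in terms of active walks -/

section Walk

variable {V : Type*} {G : Digraph V} {C : Finset V} {l : V}

/-- `Active G C l s x`: there is a walk from `l` to `x` all of whose colliders are in `C` and all
of whose other intermediate vertices are not. The flag `s` is `false` if the last edge of the walk
points to `x`, and `true` if it leaves `x` or if the walk is trivial. -/
inductive Active (G : Digraph V) (C : Finset V) (l : V) : Bool → V → Prop
  | refl : Active G C l true l
  | up_up {a u : V} : Active G C l true a → G.Adj u a → u ∉ C → Active G C l true u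
  | up_down {a b : V} : Active G C l true a → G.Adj a b → Active G C l false b
  | down_down {a b : V} : Active G C l false a → a ∉ C → G.Adj a b → Active G C l false b
  | down_up {a u : V} : Active G C l false a → a ∈ C → G.Adj u a → u ∉ C → Active G C l true u

theorem Active.trans {a x : V} {s : Bool} (h : Active G C l true a) (h' : Active G C a s x) :
    Active G C l s x := by
  induction h' with
  | refl => exact h
  | up_up _ h1 h2 ih => exact ih.up_up h1 h2
  | up_down _ h1 ih => exact ih.up_down h1
  | down_down _ h1 h2 ih => exact ih.down_down h1 h2
  | down_up _ h1 h2 h3 ih => exact ih.down_up h1 h2 h3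

/-- The walk goes down towards d, turns at the first vertex of C, a collider there, and comes back
the same way. Such detours are why colliders of active walks can be required to lie in C itself. -/
theorem Active.up_of_mem {a d : V} (h : Active G C l false a) (ha : a ∉ C)
    (had : Relation.TransGen G.Adj a d) (hd : d ∈ C) : Active G C l true a := by
  induction had using Relation.TransGen.head_induction_on with
  | single h1 => exact (h.down_down ha h1).down_up hd h1 ha
  | @head a c h1 _ ih =>
    by_cases hc : c ∈ C
    · exact (h.down_down ha h1).down_up hc h1 ha
    · exact (ih (h.down_down ha h1) hc).up_up h1 ha

theorem Active.down_of_adj {a b : V} {s : Bool} (h : Active G C l s a) (ha : a ∉ C)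
    (hab : G.Adj a b) : Active G C l false b := by
  cases s
  · exact h.down_down ha hab
  · exact h.up_down hab

/-- The condition for a path not to be blocked by `C` at an intermediate vertex. -/
def IsOpen (G : Digraph V) (C : Finset V) (p : List V) : Prop :=
  ∀ a k b, [a, k, b] <:+: p →
    (G.Adj a k ∧ G.Adj b k → k ∈ C ∨ ∃ d ∈ C, Relation.TransGen G.Adj k d) ∧
      (¬ (G.Adj a k ∧ G.Adj b k) → k ∉ C)

theorem IsOpen.of_infix {p q : List V} (h : IsOpen G C p) (hq : q <:+: p) : IsOpen G C q :=
  fun a k b hk => h a k b (hk.trans hq)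

theorem isOpen_singleton (x : V) : IsOpen G C [x] := fun a k b h => by
  have := h.length_le
  simp at this

theorem isOpen_pair (x y : V) : IsOpen G C [x, y] := fun a k b h => by
  have := h.length_le
  simp at this

theorem IsOpen.cons {x y z : V} {t : List V} (h : IsOpen G C (y :: z :: t))
    (h1 : G.Adj x y ∧ G.Adj z y → y ∈ C ∨ ∃ d ∈ C, Relation.TransGen G.Adj y d)
    (h2 : ¬ (G.Adj x y ∧ G.Adj z y) → y ∉ C) : IsOpen G C (x :: y :: z :: t) := by
  intro a k b hk
  rcases List.infix_cons_iff.1 hk with hk | hk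
  · simp only [List.cons_prefix_cons] at hk
    obtain ⟨rfl, rfl, rfl, -⟩ := hk
    exact ⟨h1, h2⟩
  · exact h a k b hk

/-- An open path from `x` to `l`, with `t` the list of the vertices after `x`. -/
structure IsOpenPath (G : Digraph V) (C : Finset V) (l x : V) (t : List V) : Prop where
  nodup : (x :: t).Nodup
  chain : (x :: t).IsChain (fun a b => G.Adj a b ∨ G.Adj b a)
  last_eq : (x :: t).getLast? = some l
  isOpen : IsOpen G C (x :: t)

/-- The path `x :: t` starts with an edge that points to `x`. -/
def StartsInto (G : Digraph V) (x : V) (t : List V) : Prop :=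
  ∃ a t', t = a :: t' ∧ G.Adj a x

theorem IsDAG.not_adj {a b : V} (hG : IsDAG G) (h : G.Adj a b) : ¬ G.Adj b a :=
  fun h' => hG a (.tail (.single h) h')

theorem IsOpenPath.of_append {x y : V} {s t t' : List V} (h : IsOpenPath G C l x t)
    (he : x :: t = s ++ y :: t') : IsOpenPath G C l y t' := by
  have hs : y :: t' <:+ x :: t := ⟨s, he.symm⟩
  refine ⟨h.nodup.sublist hs.sublist, h.chain.suffix hs, ?_, h.isOpen.of_infix hs.isInfix⟩
  have := h.last_eq
  rw [he, List.getLast?_append_of_ne_nil _ (List.cons_ne_nil _ _)] at this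
  exact this

theorem IsOpenPath.tail {x y : V} {t : List V} (h : IsOpenPath G C l x (y :: t)) :
    IsOpenPath G C l y t := h.of_append (s := [x]) rfl

theorem IsOpenPath.cons {x y : V} {t : List V} (h : IsOpenPath G C l x t) (hy : y ∉ x :: t)
    (hyx : G.Adj y x ∨ G.Adj x y)
    (h1 : G.Adj y x → StartsInto G x t → x ∈ C ∨ ∃ d ∈ C, Relation.TransGen G.Adj x d)
    (h2 : ¬ (G.Adj y x ∧ StartsInto G x t) → x ∉ C) : IsOpenPath G C l y (x :: t) := by
  refine ⟨List.nodup_cons.2 ⟨hy, h.nodup⟩, ?_, ?_, ?_⟩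
  · exact List.isChain_cons_cons.2 ⟨hyx, h.chain⟩
  · rw [List.getLast?_cons_cons]
    exact h.last_eq
  · cases t with
    | nil => exact isOpen_pair _ _
    | cons z t =>
      refine h.isOpen.cons (fun hh => h1 hh.1 ⟨z, t, rfl, hh.2⟩) fun hh => h2 ?_
      rintro ⟨h3, a, t', h4, h5⟩
      obtain ⟨rfl, rfl⟩ := List.cons_eq_cons.1 h4
      exact hh ⟨h3, h5⟩

/-- From y towards x the edges keep pointing to x until a first collider. That collider, or a
descendant of it, is in C and descends from y. -/
theorem IsOpenPath.transGen_of_adj {x y b : V} {t t' : List V} (h : IsOpenPath G C l x t)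
    (hs : b :: y :: t' <:+ x :: t) (hyb : G.Adj y b) :
    (StartsInto G x t ∧ Relation.TransGen G.Adj y x) ∨
      ∃ d ∈ C, Relation.TransGen G.Adj y d := by
  induction t generalizing x with
  | nil =>
    have := hs.length_le
    simp at this
  | cons x' t ih =>
    rcases List.suffix_cons_iff.1 hs with hs | hs
    · cases hs
      exact .inl ⟨⟨_, _, rfl, hyb⟩, .single hyb⟩
    · rcases ih h.tail hs with ⟨⟨a, t'', rfl, ha⟩, hyx⟩ | hd
      · by_cases hx : G.Adj x' x
        · exact .inl ⟨⟨_, _, rfl, hx⟩, hyx.tail hx⟩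
        · have hx' : G.Adj x x' :=
            ((List.isChain_cons_cons.1 h.chain).1).resolve_right hx
          rcases (h.isOpen x x' a ⟨[], t'', rfl⟩).1 ⟨hx', ha⟩ with hc | ⟨d, hd, hxd⟩
          · exact .inr ⟨x', hc, hyx⟩
          · exact .inr ⟨d, hd, hyx.trans hxd⟩
      · exact .inr hd

/-- If y already lies on the path, the part before y is cut off, otherwise y is prepended. A y
inside the old path whose remaining part does not start into y was a non-collider, hence outside C.
-/
theorem IsOpenPath.exists_of_adj (hG : IsDAG G) (hl : l ∉ C) {x y : V} {t : List V}
    (h : IsOpenPath G C l x t) (hx : x ∉ C) (hxy : G.Adj x y) :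
    ∃ t', IsOpenPath G C l y t' ∧ (StartsInto G y t' ∨ y ∉ C) := by
  by_cases hy : y ∈ x :: t
  · obtain ⟨s, t', he⟩ := List.append_of_mem hy
    have hp := h.of_append he
    refine ⟨t', hp, ?_⟩
    cases t' with
    | nil =>
      have := hp.last_eq
      simp only [List.getLast?_singleton, Option.some.injEq] at this
      exact .inr (this ▸ hl)
    | cons a t' =>
      by_cases ha : G.Adj a y
      · exact .inl ⟨a, t', rfl, ha⟩
      · rcases s.eq_nil_or_concat with rfl | ⟨s, b, rfl⟩
        · obtain ⟨rfl, -⟩ := List.cons_eq_cons.1 he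
          exact (hG x (.single hxy)).elim
        · refine .inr ((h.isOpen b y a ⟨s, t', ?_⟩).2 fun hh => ha hh.2)
          rw [he]
          simp
  · exact ⟨x :: t, h.cons hy (.inr hxy) (fun h' => (hG.not_adj hxy h').elim) fun _ => hx,
      .inl ⟨x, t, rfl, hxy⟩⟩

/-- Cutting at y may leave a path that starts into y, where y can later become a collider. The
discarded part then supplies a descendant of y in C, by openness at y or by
`IsOpenPath.transGen_of_adj`. -/
theorem IsOpenPath.exists_of_adj_symm (hG : IsDAG G) {x y : V} {t : List V}
    (h : IsOpenPath G C l x t)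
    (hx1 : StartsInto G x t → x ∈ C ∨ ∃ d ∈ C, Relation.TransGen G.Adj x d)
    (hx2 : ¬ StartsInto G x t → x ∉ C) (hyC : y ∉ C) (hyx : G.Adj y x) :
    ∃ t', IsOpenPath G C l y t' ∧
      (StartsInto G y t' → ∃ d ∈ C, Relation.TransGen G.Adj y d) := by
  by_cases hy : y ∈ x :: t
  · obtain ⟨s, t', he⟩ := List.append_of_mem hy
    refine ⟨t', h.of_append he, ?_⟩
    rintro ⟨a, t', rfl, ha⟩
    rcases s.eq_nil_or_concat with rfl | ⟨s, b, rfl⟩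
    · obtain ⟨rfl, -⟩ := List.cons_eq_cons.1 he
      exact (hG _ (.single hyx)).elim
    · have hi : [b, y, a] <:+: x :: t := ⟨s, t', by rw [he]; simp⟩
      by_cases hb : G.Adj b y
      · exact ((h.isOpen b y a hi).1 ⟨hb, ha⟩).resolve_left hyC
      · have hyb : G.Adj y b := by
          have := h.chain.infix hi
          simp only [List.isChain_cons_cons] at this
          exact this.1.resolve_left hb
        rcases h.transGen_of_adj (b := b) (y := y) (t' := a :: t') ⟨s, by rw [he]; simp⟩ hyb with
          ⟨h1, h2⟩ | h1
        · rcases hx1 h1 with h3 | ⟨d, hd, h3⟩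
          · exact ⟨x, h3, h2⟩
          · exact ⟨d, hd, h2.trans h3⟩
        · exact h1
  · refine ⟨x :: t, h.cons hy (.inl hyx) (fun _ => hx1) fun h' => hx2 fun h'' => h' ⟨hyx, h''⟩, ?_⟩
    rintro ⟨a, t', h1, h2⟩
    obtain ⟨rfl, rfl⟩ := List.cons_eq_cons.1 h1
    exact (hG.not_adj hyx h2).elim

/-- Active walks may be shortened to open paths. -/
theorem Active.exists_isOpenPath (hG : IsDAG G) (hl : l ∉ C) {s : Bool} {x : V}
    (h : Active G C l s x) :
    ∃ t, IsOpenPath G C l x t ∧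
      (s = true → x ∉ C ∧ (StartsInto G x t → ∃ d ∈ C, Relation.TransGen G.Adj x d)) ∧
      (s = false → StartsInto G x t ∨ x ∉ C) := by
  induction h with
  | refl =>
    refine ⟨[], ⟨by simp, by simp, by simp, isOpen_singleton _⟩, fun _ => ⟨hl, ?_⟩, by simp⟩
    rintro ⟨a, t', h, -⟩
    simp at h
  | up_up _ h1 h2 ih =>
    obtain ⟨t, ht, h3, -⟩ := ih
    obtain ⟨h3, h4⟩ := h3 rfl
    obtain ⟨t', h5, h6⟩ := ht.exists_of_adj_symm hG (fun h => .inr (h4 h)) (fun _ => h3) h2 h1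
    exact ⟨t', h5, fun _ => ⟨h2, h6⟩, by simp⟩
  | up_down _ h1 ih =>
    obtain ⟨t, ht, h3, -⟩ := ih
    obtain ⟨t', h5, h6⟩ := ht.exists_of_adj hG hl (h3 rfl).1 h1
    exact ⟨t', h5, by simp, fun _ => h6⟩
  | down_down _ h1 h2 ih =>
    obtain ⟨t, ht, -⟩ := ih
    obtain ⟨t', h5, h6⟩ := ht.exists_of_adj hG hl h1 h2
    exact ⟨t', h5, by simp, fun _ => h6⟩
  | down_up _ h1 h2 h3 ih =>
    obtain ⟨t, ht, -, h4⟩ := ih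
    obtain ⟨t', h5, h6⟩ := ht.exists_of_adj_symm hG (fun _ => .inl h1)
      (fun h => ((h4 rfl).resolve_left h)) h3 h2
    exact ⟨t', h5, fun _ => ⟨h3, h6⟩, by simp⟩

theorem eq_or_infix_of_mem {k x : V} {t : List V} (hk : k ∈ x :: t) :
    k = x ∨ (x :: t).getLast? = some k ∨ ∃ a b, [a, k, b] <:+: x :: t := by
  obtain ⟨s, t', he⟩ := List.append_of_mem hk
  rcases s.eq_nil_or_concat with rfl | ⟨s, a, rfl⟩
  · exact .inl (List.cons_eq_cons.1 he).1.symm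
  · cases t' with
    | nil => exact .inr (.inl (by rw [he]; simp))
    | cons b t' => exact .inr (.inr ⟨a, b, s, t', by rw [he]; simp⟩)

theorem not_dSep_of_active (hG : IsDAG G) (hl : l ∉ C) {i : V} (hi : i ∉ C) {s : Bool}
    (h : Active G C l s i) : ¬ DSep G {i} {l} C := by
  obtain ⟨t, ht, -⟩ := h.exists_isOpenPath hG hl
  intro hd
  obtain ⟨k, hk, hb⟩ := hd i (by simp) l (by simp) (i :: t) ⟨ht.nodup, ht.chain, rfl, ht.last_eq⟩
  rcases hb with ⟨h1, h2⟩ | ⟨⟨a, b, h1, h2⟩, h3, h4⟩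
  · rcases eq_or_infix_of_mem hk with rfl | hk | ⟨a, b, hab⟩
    · exact hi h2
    · rw [ht.last_eq, Option.some.injEq] at hk
      exact hl (hk ▸ h2)
    · exact (ht.isOpen a k b hab).2 (fun h => h1 ⟨a, b, hab, h⟩) h2
  · rcases (ht.isOpen a k b h1).1 h2 with h | ⟨d, hd, h⟩
    · exact h3 h
    · exact h4 d h hd

theorem eq_of_infix {p : List V} (hp : p.Nodup) {a k b a' b' : V} (h : [a, k, b] <:+: p)
    (h' : [a', k, b'] <:+: p) : a = a' ∧ b = b' := by
  obtain ⟨s, t, rfl⟩ := h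
  obtain ⟨s', t', he⟩ := h'
  have e : (s' ++ [a']) ++ k :: (b' :: t') = (s ++ [a]) ++ k :: (b :: t) := by simpa using he
  have hn : ((s ++ [a]) ++ k :: (b :: t)).Nodup := by simpa using hp
  rw [← e] at hn
  have hn := List.nodup_append.1 hn
  obtain ⟨e1, -, e2⟩ := (List.append_cons_inj_of_notMem (fun h => hn.2.2 k h k (by simp) rfl)
    (List.nodup_cons.1 hn.2.1).1).1 e
  simp_all

/-- The path is followed edge by edge; at a collider outside C the walk detours to a descendant in C
by `Active.up_of_mem`. -/
theorem exists_active_of_isOpen {i : V} (hl : l ∉ C) {a k : V} {t : List V} {s : Bool}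
    (ho : IsOpen G C (a :: k :: t))
    (hc : (a :: k :: t).IsChain (fun a b => G.Adj a b ∨ G.Adj b a))
    (hlast : (a :: k :: t).getLast? = some l) (hG : IsDAG G) (h : Active G C i s k)
    (hs : if s then G.Adj k a else G.Adj a k) : ∃ s, Active G C i s l := by
  induction t generalizing a k s with
  | nil =>
    simp at hlast
    exact ⟨s, hlast ▸ h⟩
  | cons b t ih =>
    have hk := ho a k b ⟨[], t, rfl⟩
    have ho' := ho.of_infix (q := k :: b :: t) ⟨[a], [], by simp⟩
    have hc' := (List.isChain_cons_cons.1 hc).2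
    have hlast' : (k :: b :: t).getLast? = some l := by simpa using hlast
    rcases (List.isChain_cons_cons.1 hc').1 with hkb | hbk
    · have hkC : k ∉ C := hk.2 fun h => hG.not_adj hkb h.2
      exact ih (s := false) ho' hc' hlast' (h.down_of_adj hkC hkb) (by simpa using hkb)
    · have hbC : b ∉ C := by
        cases t with
        | nil =>
          simp at hlast'
          exact hlast' ▸ hl
        | cons c t => exact (ho' k b c ⟨[], t, rfl⟩).2 fun h => hG.not_adj hbk h.1
      refine ih (s := true) ho' hc' hlast' ?_ (by simpa using hbk)
      cases s with
      | true => exact h.up_up hbk hbC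
      | false =>
        by_cases hkC : k ∈ C
        · exact h.down_up hkC hbk hbC
        · obtain ⟨d, hd, hkd⟩ := (hk.1 ⟨by simpa using hs, hbk⟩).resolve_left hkC
          exact (h.up_of_mem hkC hkd hd).up_up hbk hbC

theorem exists_active_of_not_dSep (hG : IsDAG G) {i : V} (hl : l ∉ C) (hil : i ≠ l)
    (h : ¬ DSep G {i} {l} C) : ∃ s, Active G C i s l := by
  simp only [DSep, Finset.mem_singleton, forall_eq, not_forall] at h
  obtain ⟨p, hp, h⟩ := h
  have ho : IsOpen G C p := by
    refine fun a k b hk => ⟨fun hab => ?_, fun hab hkC => h ⟨k, hk.subset (by simp), .inl ⟨?_, hkC⟩⟩⟩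
    · by_contra! hcon
      exact h ⟨k, hk.subset (by simp), .inr ⟨⟨a, b, hk, hab⟩, hcon.1, fun d hd hdC =>
        hcon.2 d hdC hd⟩⟩
    · rintro ⟨a', b', hk', hab'⟩
      obtain ⟨rfl, rfl⟩ := eq_of_infix hp.nodup hk hk'
      exact hab hab'
  obtain ⟨-, hc, hhead, hlast⟩ := hp
  match p, hhead with
  | [_], rfl =>
    simp at hlast
    exact (hil hlast).elim
  | _ :: k :: t, rfl =>
    rcases (List.isChain_cons_cons.1 hc).1 with hik | hki
    · exact exists_active_of_isOpen hl ho hc hlast hG (Active.refl.up_down hik) (by simpa using hik)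
    · have hkC : k ∉ C := by
        cases t with
        | nil =>
          simp at hlast
          exact hlast ▸ hl
        | cons c t => exact (ho _ k c ⟨[], t, rfl⟩).2 fun h => hG.not_adj hki h.1
      exact exists_active_of_isOpen hl ho hc hlast hG (Active.refl.up_up hki hkC)
        (by simpa using hki)

end Walk

/-! ### Analytic dependence on the edge weights -/

section Analytic

open Matrix

theorem analyticAt_mul_apply {m n o : Type*} [Fintype n] {A : ℝ → Matrix m n ℝ}
    {B : ℝ → Matrix n o ℝ} {x : ℝ} (hA : ∀ a b, AnalyticAt ℝ (fun s => A s a b) x)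
    (hB : ∀ a b, AnalyticAt ℝ (fun s => B s a b) x) (a : m) (b : o) :
    AnalyticAt ℝ (fun s => (A s * B s) a b) x := by
  simp only [Matrix.mul_apply]
  exact Finset.analyticAt_fun_sum _ fun c _ => (hA a c).mul (hB c b)

theorem analyticAt_det {n : Type*} [Fintype n] [DecidableEq n] {A : ℝ → Matrix n n ℝ} {x : ℝ}
    (hA : ∀ a b, AnalyticAt ℝ (fun s => A s a b) x) : AnalyticAt ℝ (fun s => (A s).det) x := by
  simp only [Matrix.det_apply']
  exact Finset.analyticAt_fun_sum _ fun c _ =>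
    analyticAt_const.mul (Finset.analyticAt_fun_prod _ fun d _ => hA _ _)

theorem analyticAt_inv_apply {n : Type*} [Fintype n] [DecidableEq n] {A : ℝ → Matrix n n ℝ} {x : ℝ}
    (hA : ∀ a b, AnalyticAt ℝ (fun s => A s a b) x) (hx : IsUnit (A x)) (a b : n) :
    AnalyticAt ℝ (fun s => (A s)⁻¹ a b) x := by
  simp only [Matrix.inv_def, Matrix.smul_apply, Ring.inverse_eq_inv', smul_eq_mul,
    Matrix.adjugate_apply]
  refine ((analyticAt_det hA).inv ((Matrix.isUnit_iff_isUnit_det _).1 hx).ne_zero).mul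
    (analyticAt_det fun c d => ?_)
  by_cases h : c = b
  · subst h
    simpa using analyticAt_const
  · simpa [h] using hA c d

variable {V : Type*} [Fintype V] [DecidableEq V]

theorem analyticAt_condCov {G : Digraph V} (hG : IsDAG G) {L : ℝ → Matrix V V ℝ}
    (hL : ∀ s, L s ∈ edgeWeights G) (hA : ∀ x a b, AnalyticAt ℝ (fun s => L s a b) x) {w : V → ℝ}
    (hw : ∀ v, 0 < w v) (K : Finset V) (a b : V) (x : ℝ) :
    AnalyticAt ℝ (fun s => condCov (semCov (L s, w)) K a b) x := by
  have h1 : ∀ a b, AnalyticAt ℝ (fun s => (1 - L s)⁻¹ a b) x := fun a b =>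
    analyticAt_inv_apply (fun a b => analyticAt_const.sub (hA x a b))
      (isUnit_one_sub hG (hL x)) a b
  have h2 : ∀ a b, AnalyticAt ℝ (fun s => semCov (L s, w) a b) x :=
    analyticAt_mul_apply (analyticAt_mul_apply (fun a b => h1 b a) fun a b =>
      analyticAt_const (v := diagonal w a b)) h1
  have h3 := (semCov_posDef (isUnit_one_sub hG (hL x)) hw).submatrix
    (Subtype.val_injective (p := (· ∈ K)))
  simp only [condCov, Matrix.sub_apply]
  refine (h2 a b).sub (analyticAt_mul_apply (analyticAt_mul_apply (fun a b => h2 _ _)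
    (analyticAt_inv_apply (fun a b => h2 _ _) h3.isUnit)) (fun a b => h2 _ _) a b)

/-- Two conditional covariances that are not identically zero are simultaneously nonzero. -/
theorem exists_condCov_ne_zero_and {G : Digraph V} (hG : IsDAG G) {w : V → ℝ} (hw : ∀ v, 0 < w v)
    {K K' : Finset V} {a b a' b' : V}
    (h : ∃ L ∈ edgeWeights G, condCov (semCov (L, w)) K a b ≠ 0)
    (h' : ∃ L ∈ edgeWeights G, condCov (semCov (L, w)) K' a' b' ≠ 0) :
    ∃ L ∈ edgeWeights G, condCov (semCov (L, w)) K a b ≠ 0 ∧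
      condCov (semCov (L, w)) K' a' b' ≠ 0 := by
  obtain ⟨L, hL, h⟩ := h
  obtain ⟨L', hL', h'⟩ := h'
  by_contra! hcon
  -- On the line through the two weight matrices both entries are analytic. If their product
  -- vanished, one of them would vanish identically, contrary to its value at s = 0 or s = 1.
  set M : ℝ → Matrix V V ℝ := fun s => L + s • (L' - L) with hM
  have hm : ∀ s, M s ∈ edgeWeights G := fun s u v huv => by
    simp [hM, hL u v huv, hL' u v huv]
  have hA : ∀ x a b, AnalyticAt ℝ (fun s => M s a b) x := fun x a b => by
    simp only [hM, Matrix.add_apply, Matrix.smul_apply, smul_eq_mul]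
    exact analyticAt_const.add (analyticAt_id.mul analyticAt_const)
  have H := AnalyticOnNhd.eq_zero_or_eq_zero_of_mul_eq_zero (𝕜 := ℝ) (U := Set.univ)
    (f := fun s => condCov (semCov (M s, w)) K a b)
    (g := fun s => condCov (semCov (M s, w)) K' a' b')
    (fun x _ => analyticAt_condCov hG hm hA hw K a b x)
    (fun x _ => analyticAt_condCov hG hm hA hw K' a' b' x)
    (fun x _ => mul_eq_zero.2 (or_iff_not_imp_left.2 (hcon _ (hm x)))) isPreconnected_univ
  rcases H with H | H
  · exact h (by simpa [hM] using H 0 trivial)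
  · exact h' (by simpa [hM] using H 1 trivial)

end Analytic

/-! ### Building the graph up by sinks -/

section Restrict

variable {V : Type*}

/-- The subgraph with those edges of `G` that point to a vertex in `U`. -/
def restrictHeads (G : Digraph V) (U : Finset V) : Digraph V where
  Adj u v := G.Adj u v ∧ v ∈ U

/-- A set of vertices is ancestral if it contains the parents of its elements. -/
def IsAncestral (G : Digraph V) (U : Finset V) : Prop :=
  ∀ v ∈ U, ∀ u, G.Adj u v → u ∈ U

variable {G : Digraph V} {U C C' : Finset V} {l v x : V} {s : Bool}

theorem IsDAG.restrictHeads (hG : IsDAG G) (U : Finset V) : IsDAG (restrictHeads G U) :=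
  fun v h => hG v (Relation.TransGen.mono (fun _ _ h => h.1) _ _ h)

theorem Active.mono {H : Digraph V}
    (hH : ∀ a b, H.Adj a b → G.Adj a b ∧ (a ∈ C ↔ a ∈ C') ∧ (b ∈ C ↔ b ∈ C'))
    (h : Active H C l s x) : Active G C' l s x := by
  induction h with
  | refl => exact .refl
  | up_up _ h1 h2 ih =>
    obtain ⟨h, h3, -⟩ := hH _ _ h1
    exact ih.up_up h (by rwa [← h3])
  | up_down _ h1 ih => exact ih.up_down (hH _ _ h1).1
  | down_down _ h1 h2 ih =>
    obtain ⟨h, h3, -⟩ := hH _ _ h2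
    exact ih.down_down (by rwa [← h3]) h
  | down_up _ h1 h2 h3 ih =>
    obtain ⟨h, h4, h5⟩ := hH _ _ h2
    exact ih.down_up (by rwa [← h5]) h (by rwa [← h4])

theorem Active.notMem_of_up (hl : l ∉ C) (h : Active G C l s x) : s = true → x ∉ C := by
  cases h <;> simp_all

/-- Outside of an ancestral set all vertices are isolated in the restricted graph. -/
theorem IsAncestral.ne_of_adj (hU : IsAncestral G U) (hv : v ∉ U) {a b : V}
    (h : (restrictHeads G U).Adj a b) : a ≠ v ∧ b ≠ v :=
  ⟨fun h' => hv (h' ▸ hU b h.2 a h.1), fun h' => hv (h' ▸ h.2)⟩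

theorem Active.eq_of_isolated (hU : IsAncestral G U) (hv : v ∉ U)
    (h : Active (GaussianDAG.restrictHeads G U) C v s x) : x = v := by
  induction h with
  | refl => rfl
  | up_up _ h1 _ ih => exact ((hU.ne_of_adj hv h1).2 ih).elim
  | up_down _ h1 ih => exact ((hU.ne_of_adj hv h1).1 ih).elim
  | down_down _ _ h1 ih => exact ((hU.ne_of_adj hv h1).1 ih).elim
  | down_up _ _ h1 _ ih => exact ((hU.ne_of_adj hv h1).2 ih).elim

theorem Active.eq_of_isolated' (hU : IsAncestral G U) (hv : v ∉ U)
    (h : Active (GaussianDAG.restrictHeads G U) C l s v) : l = v := by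
  cases h with
  | refl => rfl
  | up_up _ h1 => exact ((hU.ne_of_adj hv h1).1 rfl).elim
  | up_down _ h1 => exact ((hU.ne_of_adj hv h1).2 rfl).elim
  | down_down _ _ h1 => exact ((hU.ne_of_adj hv h1).2 rfl).elim
  | down_up _ _ h1 => exact ((hU.ne_of_adj hv h1).1 rfl).elim

variable [DecidableEq V]

/-- An ancestral set is built up by successively adding sinks. -/
theorem IsAncestral.induction [Finite V] (hG : IsDAG G) {P : ∀ U, IsAncestral G U → Prop}
    (h0 : ∀ h, P ∅ h)
    (h1 : ∀ U v (hU : IsAncestral G U) (_ : v ∉ U) (hU' : IsAncestral G (insert v U)), P U hU →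
      P (insert v U) hU')
    (U : Finset V) (hU : IsAncestral G U) : P U hU := by
  induction hn : U.card generalizing U with
  | zero =>
    obtain rfl := Finset.card_eq_zero.1 hn
    exact h0 hU
  | succ n ih =>
    have hne : (U : Set V).Nonempty := by
      rw [Finset.coe_nonempty, ← Finset.card_pos]
      omega
    -- The order is reversed reachability, so a minimal v has no descendant in U and its removal
    -- leaves an ancestral set.
    obtain ⟨v, hv, hmin⟩ := hG.wellFounded.has_min _ hne
    have hU' : IsAncestral G (U.erase v) := fun x hx u hux => by
      have hx := Finset.mem_of_mem_erase hx
      exact Finset.mem_erase.2 ⟨fun h => hmin x hx (.single (h ▸ hux)), hU x hx u hux⟩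
    have := h1 (U.erase v) v hU' (by simp) (by rwa [Finset.insert_erase hv])
      (ih _ hU' (by rw [Finset.card_erase_of_mem hv]; omega))
    simpa only [Finset.insert_erase hv] using this

theorem restrictHeads_insert_adj (hG : IsDAG G) (hU : IsAncestral G U) (hv : v ∉ U) {a b : V}
    (h : (restrictHeads G (insert v U)).Adj a b) :
    a ≠ v ∧ (b = v ∧ G.Adj a v ∨ b ≠ v ∧ (restrictHeads G U).Adj a b) := by
  obtain ⟨h1, h2⟩ := h
  rcases Finset.mem_insert.1 h2 with rfl | h2
  · refine ⟨?_, .inl ⟨rfl, h1⟩⟩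
    rintro rfl
    exact hG a (.single h1)
  · exact ⟨(hU.ne_of_adj hv ⟨h1, h2⟩).1, .inr ⟨(hU.ne_of_adj hv ⟨h1, h2⟩).2, h1, h2⟩⟩

/-- Decomposition of a walk at a sink `v` that is not its start. -/
theorem Active.of_insert (hG : IsDAG G) (hU : IsAncestral G U) (hv : v ∉ U) (hl : l ∉ C) (hlv : l ≠ v)
    (h : Active (GaussianDAG.restrictHeads G (insert v U)) C l s x) :
    (x ≠ v ∧ Active (GaussianDAG.restrictHeads G U) C l s x) ∨
    (x = v ∧ s = false ∧ ∃ b, G.Adj b v ∧ b ∉ C ∧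
      ∃ s', Active (GaussianDAG.restrictHeads G U) C l s' b) ∨
    (x ≠ v ∧ v ∈ C ∧ ∃ b a, G.Adj b v ∧ G.Adj a v ∧ b ∉ C ∧ a ∉ C ∧
      (∃ s', Active (GaussianDAG.restrictHeads G U) C l s' b) ∧
      Active (GaussianDAG.restrictHeads G U) C a s x) := by
  -- A sink can be an inner vertex of an active walk only as a collider in C. In the last
  -- alternative b precedes the first visit to v and a follows the last one; what lies between is
  -- dropped.
  induction h with
  | refl => exact .inl ⟨hlv, .refl⟩
  | @up_up a u _ h1 h2 ih =>
    obtain ⟨huv, ⟨rfl, h1⟩ | ⟨hav, h1⟩⟩ := restrictHeads_insert_adj hG hU hv h1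
    · rcases ih with ⟨h, -⟩ | ⟨-, h, -⟩ | ⟨h, -⟩
      · exact (h rfl).elim
      · simp at h
      · exact (h rfl).elim
    · rcases ih with ⟨-, h⟩ | ⟨h, -⟩ | ⟨-, hvC, b, a, hb, ha, hbC, haC, hs, h⟩
      · exact .inl ⟨huv, h.up_up h1 h2⟩
      · exact (hav h).elim
      · exact .inr (.inr ⟨huv, hvC, b, a, hb, ha, hbC, haC, hs, h.up_up h1 h2⟩)
  | @up_down a b h0 h1 ih =>
    have haC := h0.notMem_of_up hl rfl
    obtain ⟨hav, ⟨rfl, h1⟩ | ⟨hbv, h1⟩⟩ := restrictHeads_insert_adj hG hU hv h1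
    · rcases ih with ⟨-, h⟩ | ⟨h, -⟩ | ⟨-, hvC, b, a', hb, ha, hbC, haC, hs, h⟩
      · exact .inr (.inl ⟨rfl, rfl, a, h1, haC, _, h⟩)
      · exact (hav h).elim
      · exact .inr (.inl ⟨rfl, rfl, b, hb, hbC, hs⟩)
    · rcases ih with ⟨-, h⟩ | ⟨h, -⟩ | ⟨-, hvC, b, a, hb, ha, hbC, haC, hs, h⟩
      · exact .inl ⟨hbv, h.up_down h1⟩
      · exact (hav h).elim
      · exact .inr (.inr ⟨hbv, hvC, b, a, hb, ha, hbC, haC, hs, h.up_down h1⟩)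
  | @down_down a b _ haC h1 ih =>
    obtain ⟨hav, ⟨rfl, h1⟩ | ⟨hbv, h1⟩⟩ := restrictHeads_insert_adj hG hU hv h1
    · rcases ih with ⟨-, h⟩ | ⟨h, -⟩ | ⟨-, hvC, b, a', hb, ha, hbC, -, hs, h⟩
      · exact .inr (.inl ⟨rfl, rfl, a, h1, haC, _, h⟩)
      · exact (hav h).elim
      · exact .inr (.inl ⟨rfl, rfl, b, hb, hbC, hs⟩)
    · rcases ih with ⟨-, h⟩ | ⟨h, -⟩ | ⟨-, hvC, b, a, hb, ha, hbC, haC', hs, h⟩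
      · exact .inl ⟨hbv, h.down_down haC h1⟩
      · exact (hav h).elim
      · exact .inr (.inr ⟨hbv, hvC, b, a, hb, ha, hbC, haC', hs, h.down_down haC h1⟩)
  | @down_up a u _ haC h1 h2 ih =>
    obtain ⟨huv, ⟨rfl, h1⟩ | ⟨hav, h1⟩⟩ := restrictHeads_insert_adj hG hU hv h1
    · rcases ih with ⟨h, -⟩ | ⟨-, -, b, hb, hbC, hs⟩ | ⟨h, -⟩
      · exact (h rfl).elim
      · exact .inr (.inr ⟨huv, haC, b, u, hb, h1, hbC, h2, hs, .refl⟩)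
      · exact (h rfl).elim
    · rcases ih with ⟨-, h⟩ | ⟨h, -⟩ | ⟨-, hvC, b, a, hb, ha, hbC, haC', hs, h⟩
      · exact .inl ⟨huv, h.down_up haC h1 h2⟩
      · exact (hav h).elim
      · exact .inr (.inr ⟨huv, hvC, b, a, hb, ha, hbC, haC', hs, h.down_up haC h1 h2⟩)

/-- Decomposition of a walk that starts at a sink `v`. -/
theorem Active.of_insert_self (hG : IsDAG G) (hU : IsAncestral G U) (hv : v ∉ U) (hvC : v ∉ C)
    (h : Active (GaussianDAG.restrictHeads G (insert v U)) C v s x) :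
    x = v ∨ (x ≠ v ∧ ∃ u, G.Adj u v ∧ u ∉ C ∧
      Active (GaussianDAG.restrictHeads G U) C u s x) := by
  induction h with
  | refl => exact .inl rfl
  | @up_up a u _ h1 h2 ih =>
    obtain ⟨huv, ⟨rfl, h1⟩ | ⟨hav, h1⟩⟩ := restrictHeads_insert_adj hG hU hv h1
    · exact .inr ⟨huv, u, h1, h2, .refl⟩
    · obtain ⟨-, a, ha, haC, h⟩ := ih.resolve_left hav
      exact .inr ⟨huv, a, ha, haC, h.up_up h1 h2⟩
  | @up_down a b _ h1 ih =>
    obtain ⟨hav, ⟨rfl, h1⟩ | ⟨hbv, h1⟩⟩ := restrictHeads_insert_adj hG hU hv h1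
    · exact .inl rfl
    · obtain ⟨-, a, ha, haC, h⟩ := ih.resolve_left hav
      exact .inr ⟨hbv, a, ha, haC, h.up_down h1⟩
  | @down_down a b _ h2 h1 ih =>
    obtain ⟨hav, ⟨rfl, h1⟩ | ⟨hbv, h1⟩⟩ := restrictHeads_insert_adj hG hU hv h1
    · exact .inl rfl
    · obtain ⟨-, a, ha, haC, h⟩ := ih.resolve_left hav
      exact .inr ⟨hbv, a, ha, haC, h.down_down h2 h1⟩
  | @down_up a u _ h3 h1 h2 ih =>
    obtain ⟨huv, ⟨rfl, h1⟩ | ⟨hav, h1⟩⟩ := restrictHeads_insert_adj hG hU hv h1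
    · exact (hvC h3).elim
    · obtain ⟨-, a, ha, haC, h⟩ := ih.resolve_left hav
      exact .inr ⟨huv, a, ha, haC, h.down_up h3 h1 h2⟩

end Restrict

/-! ### Adding a sink to a Gaussian model -/

section Sink

open Matrix

variable {V : Type*} [Fintype V] [DecidableEq V]

/-- The transformation that adds the linear combination `y` of the other variables to `v`. -/
def sinkTransform (y : V → ℝ) (v : V) : Matrix V V ℝ :=
  1 + vecMulVec y (Pi.single v 1)

/-- Since v has no children, I - Λ = (I - E)(I - Λ₀), where Λ₀ is Λ without the weights into v and E
= y e_vᵀ. As y_v = 0, E² = 0 and I + E inverts I - E. -/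
theorem semCov_of_row_eq_zero {L : Matrix V V ℝ} {w : V → ℝ} {v : V} (hv : ∀ b, L v b = 0) :
    semCov (L, w) = (sinkTransform (L.col v) v)ᵀ * semCov (L.updateCol v 0, w) *
      sinkTransform (L.col v) v := by
  set E := vecMulVec (L.col v) (Pi.single v 1) with hE
  have h1 : (1 - E) * (1 + E) = 1 := by
    have : E * E = 0 := by
      rw [hE, Matrix.vecMulVec_mul_vecMulVec]
      simp [hv]
    rw [sub_mul, mul_add, mul_add, this]
    simp
  have h2 : 1 - L = (1 - E) * (1 - L.updateCol v 0) := by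
    have h3 : E * (L.updateCol v 0) = 0 := by
      ext a b
      simp [hE, Matrix.mul_apply, Matrix.vecMulVec_apply, Pi.single_apply, Matrix.updateCol_apply,
        hv]
    have h4 : L.updateCol v 0 + E = L := by
      ext a b
      by_cases h : b = v
      · subst h
        simp [hE, Matrix.vecMulVec_apply]
      · simp [hE, Matrix.vecMulVec_apply, h]
    rw [mul_sub, sub_mul 1 E (L.updateCol v 0), h3, mul_one, one_mul, sub_zero]
    nth_rw 1 [← h4]
    abel
  have h5 : (1 - L)⁻¹ = (1 - L.updateCol v 0)⁻¹ * (1 + E) := by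
    rw [h2, Matrix.mul_inv_rev, Matrix.inv_eq_right_inv h1]
  rw [semCov, semCov, h5, sinkTransform, ← hE, Matrix.transpose_mul]
  simp only [Matrix.mul_assoc]

theorem transpose_mul_mul_apply (M : Matrix V V ℝ) (y : V → ℝ) {v a b : V} (ha : a ≠ v)
    (hb : b ≠ v) :
    ((sinkTransform y v)ᵀ * M * sinkTransform y v) a b = M a b := by
  simp [sinkTransform, Matrix.mul_apply, Matrix.vecMulVec_apply, Matrix.one_apply, ha, hb]

theorem transpose_mul_mul_apply_left (M : Matrix V V ℝ) (y : V → ℝ) {v b : V} (hb : b ≠ v) :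
    ((sinkTransform y v)ᵀ * M * sinkTransform y v) v b =
      M v b + ∑ u, y u * M u b := by
  simp [sinkTransform, Matrix.mul_apply, Matrix.vecMulVec_apply, Matrix.one_apply, hb, add_mul]

theorem transpose_mul_mul_apply_right (M : Matrix V V ℝ) (y : V → ℝ) {v a : V} (ha : a ≠ v) :
    ((sinkTransform y v)ᵀ * M * sinkTransform y v) a v =
      M a v + ∑ u, M a u * y u := by
  simp [sinkTransform, Matrix.mul_apply, Matrix.vecMulVec_apply, Matrix.one_apply, ha, mul_add,
    Finset.sum_add_distrib]

theorem condCov_of_row_eq_zero {L : Matrix V V ℝ} {w : V → ℝ} {v : V} (hv : ∀ b, L v b = 0)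
    {K : Finset V} (hvK : v ∉ K) :
    condCov (semCov (L, w)) K =
      (sinkTransform (L.col v) v)ᵀ * condCov (semCov (L.updateCol v 0, w)) K *
        sinkTransform (L.col v) v := by
  rw [semCov_of_row_eq_zero hv, condCov_congr_mul]
  intro k hk a
  have : k ≠ v := fun h => hvK (h ▸ hk)
  simp [sinkTransform, Matrix.vecMulVec_apply, this]

theorem condCov_zero {w : V → ℝ} (hw : ∀ v, 0 < w v) {K : Finset V} {i l : V} (hil : i ≠ l)
    (hl : l ∉ K) : condCov (semCov ((0 : Matrix V V ℝ), w)) K i l = 0 := by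
  have h1 : IsUnit (1 - (0 : Matrix V V ℝ)) := by simp
  have := eq_mul_condCov_of_inv_mulVec (semCov_posDef h1 hw) (K := K) (b := l)
    (w := Pi.single l (w l)) (r := 1) ?_ ?_ i
  · rw [one_mul, Pi.single_eq_of_ne hil] at this
    exact this.symm
  · intro a ha
    rw [Pi.single_eq_of_ne]
    exact fun h => hl (h ▸ ha)
  · intro a _
    rw [semCov_inv_mulVec h1 hw]
    by_cases h : a = l
    · subst h
      simp [Matrix.col, Matrix.one_apply, (hw a).ne']
    · simp [Matrix.col, h, Matrix.one_apply]

end Sink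

/-! ### The global Markov property and its generic converse -/

section Markov

open Matrix

variable {V : Type*} {G : Digraph V}

theorem edgeWeights_mono {H : Digraph V} (h : ∀ a b, H.Adj a b → G.Adj a b) :
    edgeWeights H ⊆ edgeWeights G :=
  fun _ hL a b hab => hL a b fun h' => hab (h a b h')

theorem exists_adj_of_sum_ne_zero [Fintype V] {v : V} {L : Matrix V V ℝ} (hL : L ∈ edgeWeights G) {f : V → ℝ}
    (h : ∑ u, L u v * f u ≠ 0) : ∃ u, G.Adj u v ∧ f u ≠ 0 := by
  obtain ⟨u, -, hu⟩ := Finset.exists_ne_zero_of_sum_ne_zero h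
  refine ⟨u, ?_, right_ne_zero_of_mul hu⟩
  by_contra hn
  exact left_ne_zero_of_mul hu (hL u v hn)

theorem restrictHeads_univ [Fintype V] : restrictHeads G Finset.univ = G := by
  simp [restrictHeads]

/-- Each nonzero linear form vanishes at no more than one of (1,0), (0,1), (1,1), (1,-1). -/
theorem exists_mul_add_ne_zero {a b c d : ℝ} (h : a ≠ 0 ∨ b ≠ 0) (h' : c ≠ 0 ∨ d ≠ 0) :
    ∃ x y : ℝ, a * x + b * y ≠ 0 ∧ c * x + d * y ≠ 0 := by
  by_contra! hcon
  have h1 := hcon 1 0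
  have h2 := hcon 0 1
  have h3 := hcon 1 1
  have h4 := hcon 1 (-1)
  grind

variable [DecidableEq V]

theorem restrictHeads_adj_insert {U : Finset V} {v a b : V} (h : (restrictHeads G U).Adj a b) :
    (restrictHeads G (insert v U)).Adj a b :=
  ⟨h.1, Finset.mem_insert_of_mem h.2⟩

theorem Active.insert {U : Finset V} {v l x : V} {s : Bool} {C : Finset V}
    (h : Active (restrictHeads G U) C l s x) :
    Active (restrictHeads G (insert v U)) C l s x :=
  h.mono fun _ _ h => ⟨restrictHeads_adj_insert h, .rfl, .rfl⟩

theorem Active.insert_erase {U : Finset V} (hU : IsAncestral G U) {v l x : V} {s : Bool}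
    {C : Finset V} (hv : v ∉ U) (h : Active (restrictHeads G U) (C.erase v) l s x) :
    Active (restrictHeads G (Insert.insert v U)) C l s x :=
  h.mono fun a b h => by
    obtain ⟨h1, h2⟩ := hU.ne_of_adj hv h
    simp [restrictHeads_adj_insert h, h1, h2]

theorem Active.erase {U : Finset V} (hU : IsAncestral G U) {v l x : V} {s : Bool}
    {C : Finset V} (hv : v ∉ U) (h : Active (restrictHeads G U) C l s x) :
    Active (restrictHeads G U) (C.erase v) l s x :=
  h.mono fun a b h => by
    obtain ⟨h1, h2⟩ := hU.ne_of_adj hv h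
    simp [h, h1, h2]

theorem apply_eq_zero_of_sink (hG : IsDAG G) {U : Finset V} (hU : IsAncestral G U) {v : V}
    (hv : v ∉ U) {L : Matrix V V ℝ} (hL : L ∈ edgeWeights (restrictHeads G (insert v U))) (b : V) :
    L v b = 0 :=
  hL v b fun h => (restrictHeads_insert_adj hG hU hv h).1 rfl

theorem updateCol_zero_mem {U : Finset V} {v : V} {L : Matrix V V ℝ}
    (hL : L ∈ edgeWeights (restrictHeads G (insert v U))) :
    L.updateCol v 0 ∈ edgeWeights (restrictHeads G U) := fun a b hab => by
  by_cases h : b = v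
  · subst h
    simp
  · rw [Matrix.updateCol_ne h]
    refine hL a b fun h' => hab ⟨h'.1, ?_⟩
    exact (Finset.mem_insert.1 h'.2).resolve_left h

theorem updateCol_mem {U : Finset V} {v : V} {L : Matrix V V ℝ}
    (hL : L ∈ edgeWeights (restrictHeads G U)) {y : V → ℝ} (hy : ∀ u, y u ≠ 0 → G.Adj u v) :
    L.updateCol v y ∈ edgeWeights (restrictHeads G (insert v U)) := fun a b hab => by
  by_cases h : b = v
  · subst h
    rw [Matrix.updateCol_self]
    by_contra hne
    exact hab ⟨hy a hne, Finset.mem_insert_self _ _⟩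
  · rw [Matrix.updateCol_ne h]
    exact hL a b fun h' => hab (restrictHeads_adj_insert h')

theorem updateCol_updateCol_zero {U : Finset V} {v : V} (hv : v ∉ U) {L : Matrix V V ℝ}
    (hL : L ∈ edgeWeights (restrictHeads G U)) (y : V → ℝ) :
    (L.updateCol v y).updateCol v 0 = L := by
  ext a b
  by_cases h : b = v
  · subst h
    rw [Matrix.updateCol_self, hL a b fun h => hv h.2, Pi.zero_apply]
  · simp [h]

variable [Fintype V]

/-- Conditional covariances that do not vanish come from active walks. -/
theorem exists_active_of_condCov_ne_zero (hG : IsDAG G) {w : V → ℝ} (hw : ∀ v, 0 < w v)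
    (U : Finset V) (hU : IsAncestral G U) {L : Matrix V V ℝ}
    (hL : L ∈ edgeWeights (restrictHeads G U)) {C : Finset V} {i l : V} (hi : i ∉ C) (hl : l ∉ C)
    (h : condCov (semCov (L, w)) C i l ≠ 0) : ∃ s, Active (restrictHeads G U) C l s i := by
  induction U, hU using IsAncestral.induction hG generalizing L C i l with
  | h0 =>
    by_cases hil : i = l
    · exact ⟨true, hil ▸ .refl⟩
    · have : L = 0 := by
        ext a b
        exact hL a b fun h => by simpa using h.2
      rw [this, condCov_zero hw hil hl] at h
      exact (h rfl).elim
  | h1 U v hU hv hU' ih =>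
    by_cases hil : i = l
    · exact ⟨true, hil ▸ .refl⟩
    have hrow := apply_eq_zero_of_sink hG hU hv hL
    have hL' := updateCol_zero_mem hL
    have hS' := semCov_posDef (isUnit_one_sub (hG.restrictHeads U) hL') hw
    have hS := semCov_posDef (isUnit_one_sub (hG.restrictHeads _) hL) hw
    have hadj : ∀ u, G.Adj u v → (restrictHeads G (insert v U)).Adj u v := fun u h =>
      ⟨h, Finset.mem_insert_self _ _⟩
    by_cases hvC : v ∈ C
    · set C' := C.erase v with hC'
      have hvC' : v ∉ C' := by simp [hC']
      have hlv : l ≠ v := fun h => hl (h ▸ hvC)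
      have hiv : i ≠ v := fun h => hi (h ▸ hvC)
      have hi' : i ∉ C' := fun h => hi (Finset.mem_of_mem_erase h)
      have hl' : l ∉ C' := fun h => hl (Finset.mem_of_mem_erase h)
      rw [← Finset.insert_erase hvC, ← hC', condCov_insert hS hvC' hlv,
        condCov_of_row_eq_zero hrow hvC', transpose_mul_mul_apply _ _ hiv hlv,
        transpose_mul_mul_apply_left _ _ hlv, transpose_mul_mul_apply_right _ _ hiv] at h
      by_cases h1 : condCov (semCov (L.updateCol v 0, w)) C' i l = 0
      · rw [h1, zero_sub, neg_ne_zero, div_ne_zero_iff, mul_ne_zero_iff] at h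
        obtain ⟨⟨h2, h3⟩, -⟩ := h
        -- Before its edges are added v is isolated, so its covariances with i and l come only from
        -- the new edges, that is, from parents a and b.
        have h4 : condCov (semCov (L.updateCol v 0, w)) C' i v = 0 := by
          by_contra h4
          obtain ⟨s, h5⟩ := ih hL' hi' hvC' h4
          exact hiv (h5.eq_of_isolated hU hv)
        have h5 : condCov (semCov (L.updateCol v 0, w)) C' v l = 0 := by
          by_contra h5
          obtain ⟨s, h6⟩ := ih hL' hvC' hl' h5
          exact hlv (h6.eq_of_isolated' hU hv)
        rw [h4, zero_add] at h2
        rw [h5, zero_add] at h3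
        simp only [mul_comm (condCov _ _ _ _) (L.col v _)] at h2
        obtain ⟨a, ha, ha'⟩ := exists_adj_of_sum_ne_zero hL h2
        obtain ⟨b, hb, hb'⟩ := exists_adj_of_sum_ne_zero hL h3
        have haC : a ∉ C' := fun h => ha' (by rw [condCov_comm hS', condCov_of_mem hS' h])
        have hbC : b ∉ C' := fun h => hb' (condCov_of_mem hS' h _)
        have hav := (restrictHeads_insert_adj hG hU hv ha).1
        have hbv := (restrictHeads_insert_adj hG hU hv hb).1
        have haC' : a ∉ C := by simpa [hC', hav] using haC
        have hbC' : b ∉ C := by simpa [hC', hbv] using hbC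
        obtain ⟨s, h6⟩ := ih hL' hi' haC ha'
        obtain ⟨s', h7⟩ := ih hL' hbC hl' hb'
        -- The two walks are joined through b → v ← a, with v a collider in C.
        exact ⟨s, (((h7.insert_erase hU hv).down_of_adj hbC' hb).down_up hvC ha haC').trans
          (h6.insert_erase hU hv)⟩
      · obtain ⟨s, h2⟩ := ih hL' hi' hl' h1
        exact ⟨s, h2.insert_erase hU hv⟩
    · rw [condCov_of_row_eq_zero hrow hvC] at h
      by_cases hiv : i = v
      · subst hiv
        rw [transpose_mul_mul_apply_left _ _ (Ne.symm hil)] at h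
        by_cases h1 : condCov (semCov (L.updateCol i 0, w)) C i l = 0
        · rw [h1, zero_add] at h
          obtain ⟨b, hb, hb'⟩ := exists_adj_of_sum_ne_zero hL h
          have hbC : b ∉ C := fun h => hb' (condCov_of_mem hS' h _)
          obtain ⟨s, h2⟩ := ih hL' hbC hl hb'
          exact ⟨false, h2.insert.down_of_adj hbC hb⟩
        · obtain ⟨s, h2⟩ := ih hL' hi hl h1
          exact ⟨s, h2.insert⟩
      · by_cases hlv : l = v
        · subst hlv
          rw [transpose_mul_mul_apply_right _ _ hiv] at h
          by_cases h1 : condCov (semCov (L.updateCol l 0, w)) C i l = 0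
          · rw [h1, zero_add] at h
            simp only [mul_comm (condCov _ _ _ _) (L.col l _)] at h
            obtain ⟨a, ha, ha'⟩ := exists_adj_of_sum_ne_zero hL h
            have haC : a ∉ C := fun h => ha' (by rw [condCov_comm hS', condCov_of_mem hS' h])
            obtain ⟨s, h2⟩ := ih hL' hi haC ha'
            exact ⟨s, (Active.refl.up_up ha haC).trans h2.insert⟩
          · obtain ⟨s, h2⟩ := ih hL' hi hl h1
            exact ⟨s, h2.insert⟩
        · rw [transpose_mul_mul_apply _ _ hiv hlv] at h
          obtain ⟨s, h2⟩ := ih hL' hi hl h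
          exact ⟨s, h2.insert⟩

/-- Active walks give rise to conditional covariances that do not vanish identically. -/
theorem exists_condCov_ne_zero_of_active (hG : IsDAG G) {w : V → ℝ} (hw : ∀ v, 0 < w v)
    (U : Finset V) (hU : IsAncestral G U) {C : Finset V} {i l : V} (hi : i ∉ C) (hl : l ∉ C)
    (h : ∃ s, Active (restrictHeads G U) C l s i) :
    ∃ L ∈ edgeWeights (restrictHeads G U), condCov (semCov (L, w)) C i l ≠ 0 := by
  induction U, hU using IsAncestral.induction hG generalizing C i l with
  | h0 =>
    obtain ⟨s, h⟩ := h
    have hil : i = l := h.eq_of_isolated (U := ∅) (fun v hv => by simp at hv) (by simp)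
    subst hil
    refine ⟨0, fun _ _ _ => rfl, (condCov_self_pos (semCov_posDef ?_ hw) hi).ne'⟩
    simp
  | h1 U v hU hv hU' ih =>
    obtain ⟨s, h⟩ := h
    by_cases hil : i = l
    · subst hil
      refine ⟨0, fun _ _ _ => rfl, (condCov_self_pos (semCov_posDef ?_ hw) hi).ne'⟩
      simp
    have hmono : edgeWeights (restrictHeads G U) ⊆ edgeWeights (restrictHeads G (insert v U)) :=
      edgeWeights_mono fun _ _ => restrictHeads_adj_insert
    have hpos : ∀ L ∈ edgeWeights (restrictHeads G U), (semCov (L, w)).PosDef := fun L hL =>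
      semCov_posDef (isUnit_one_sub (hG.restrictHeads U) hL) hw
    have hstep : ∀ L ∈ edgeWeights (restrictHeads G U), ∀ y : V → ℝ, (∀ u, y u ≠ 0 → G.Adj u v) →
        ∀ C, v ∉ C → condCov (semCov (L.updateCol v y, w)) C =
          (sinkTransform y v)ᵀ * condCov (semCov (L, w)) C * sinkTransform y v := by
      intro L hL y hy C hvC
      have hL' := updateCol_mem hL hy
      rw [condCov_of_row_eq_zero (apply_eq_zero_of_sink hG hU hv hL') hvC,
        updateCol_updateCol_zero hv hL]
      have : (L.updateCol v y).col v = y := by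
        ext
        simp
      rw [this]
    by_cases hvC : v ∈ C
    · have hlv : l ≠ v := fun h => hl (h ▸ hvC)
      have hiv : i ≠ v := fun h => hi (h ▸ hvC)
      have hi' : i ∉ C.erase v := fun h => hi (Finset.mem_of_mem_erase h)
      have hl' : l ∉ C.erase v := fun h => hl (Finset.mem_of_mem_erase h)
      have hv' : v ∉ C.erase v := by simp
      have hiso1 : ∀ L ∈ edgeWeights (restrictHeads G U),
          condCov (semCov (L, w)) (C.erase v) i v = 0 := fun L hL => by
        by_contra hne
        obtain ⟨s, h⟩ := exists_active_of_condCov_ne_zero hG hw U hU hL hi' hv' hne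
        exact hiv (h.eq_of_isolated hU hv)
      have hiso2 : ∀ L ∈ edgeWeights (restrictHeads G U),
          condCov (semCov (L, w)) (C.erase v) v l = 0 := fun L hL => by
        rw [condCov_comm (hpos L hL)]
        by_contra hne
        obtain ⟨s, h⟩ := exists_active_of_condCov_ne_zero hG hw U hU hL hl' hv' hne
        exact hlv (h.eq_of_isolated hU hv)
      have hkeep : ∀ L ∈ edgeWeights (restrictHeads G U),
          condCov (semCov (L, w)) (C.erase v) i l ≠ 0 →
          ∃ L ∈ edgeWeights (restrictHeads G (insert v U)),
            condCov (semCov (L, w)) C i l ≠ 0 := fun L hL h => by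
        refine ⟨L, hmono hL, ?_⟩
        rwa [← Finset.insert_erase hvC, condCov_insert (hpos L hL) hv' hlv, hiso1 L hL, zero_mul,
          zero_div, sub_zero]
      rcases h.of_insert hG hU hv hl hlv with
        ⟨-, h⟩ | ⟨h, -⟩ | ⟨-, -, b, a, hb, ha, hbC, haC, ⟨s', h1⟩, h2⟩
      · obtain ⟨L, hL, h⟩ := ih hi' hl' ⟨s, h.erase hU hv⟩
        exact hkeep L hL h
      · exact (hiv h).elim
      · have haC' : a ∉ C.erase v := fun h => haC (Finset.mem_of_mem_erase h)
        have hbC' : b ∉ C.erase v := fun h => hbC (Finset.mem_of_mem_erase h)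
        -- Conditioning on v produces the product of σ_iv and σ_vl, so both ends must be dependent
        -- for the same weights.
        obtain ⟨L, hL, h3, h4⟩ := exists_condCov_ne_zero_and (hG.restrictHeads U) hw
          (ih hi' haC' ⟨s, h2.erase hU hv⟩) (ih hbC' hl' ⟨s', h1.erase hU hv⟩)
        by_cases h5 : condCov (semCov (L, w)) (C.erase v) i l = 0
        · set M := condCov (semCov (L, w)) (C.erase v) with hM
          obtain ⟨x, y, h6, h7⟩ := exists_mul_add_ne_zero (a := M i a) (b := M i b) (c := M a l)
            (d := M b l) (.inl h3) (.inr h4)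
          -- Weights x on a → v and y on b → v, which add up if a = b, chosen so that v is
          -- correlated with both i and l.
          set z : V → ℝ := x • Pi.single a 1 + y • Pi.single b 1 with hz
          have hzadj : ∀ u, z u ≠ 0 → G.Adj u v := fun u hu => by
            by_contra hn
            have h8 : u ≠ a := fun h => hn (h ▸ ha)
            have h9 : u ≠ b := fun h => hn (h ▸ hb)
            simp [hz, h8, h9] at hu
          have hL' := updateCol_mem hL hzadj
          have hS := semCov_posDef (isUnit_one_sub (hG.restrictHeads _) hL') hw
          refine ⟨_, hL', ?_⟩
          rw [← Finset.insert_erase hvC, condCov_insert hS hv' hlv, hstep L hL z hzadj _ hv', ← hM,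
            transpose_mul_mul_apply _ _ hiv hlv, transpose_mul_mul_apply_left _ _ hlv,
            transpose_mul_mul_apply_right _ _ hiv, h5, zero_sub, neg_ne_zero, div_ne_zero_iff,
            mul_ne_zero_iff, hM, hiso1 L hL, hiso2 L hL, ← hM, ← hstep L hL z hzadj _ hv']
          refine ⟨⟨?_, ?_⟩, (condCov_self_pos hS hv').ne'⟩
          · rw [zero_add]
            convert h6 using 1
            simp [hz, mul_add, Finset.sum_add_distrib, Pi.single_apply]
          · rw [zero_add]
            convert h7 using 1
            simp [hz, add_mul, Finset.sum_add_distrib, Pi.single_apply, mul_comm]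
        · exact hkeep L hL h5
    -- If v is not yet correlated with c, the single edge u → v of weight 1 passes the covariance of
    -- u with c on to v.
    · have hone : ∀ L ∈ edgeWeights (restrictHeads G U), ∀ u, G.Adj u v →
          ∀ c ≠ v, condCov (semCov (L, w)) C u c ≠ 0 →
          ∃ L ∈ edgeWeights (restrictHeads G (insert v U)),
            condCov (semCov (L, w)) C v c ≠ 0 := by
        intro L hL u hu c hc h
        by_cases h1 : condCov (semCov (L, w)) C v c = 0
        · have hadj : ∀ x, (Pi.single u 1 : V → ℝ) x ≠ 0 → G.Adj x v := fun x hx => by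
            by_cases h : x = u
            · exact h ▸ hu
            · simp [h] at hx
          refine ⟨_, updateCol_mem hL hadj, ?_⟩
          rw [hstep L hL _ hadj C hvC, transpose_mul_mul_apply_left _ _ hc, h1, zero_add]
          simpa [Pi.single_apply] using h
        · exact ⟨L, hmono hL, h1⟩
      by_cases hlv : l = v
      · subst hlv
        obtain ⟨-, u, hu, huC, h⟩ := (h.of_insert_self hG hU hv hvC).resolve_left hil
        obtain ⟨L, hL, h⟩ := ih hi huC ⟨s, h⟩
        rw [condCov_comm (hpos L hL)] at h
        obtain ⟨L', hL', h'⟩ := hone L hL u hu i hil h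
        rw [condCov_comm (semCov_posDef (isUnit_one_sub (hG.restrictHeads _) hL') hw)] at h'
        exact ⟨L', hL', h'⟩
      · rcases h.of_insert hG hU hv hl hlv with
          ⟨-, h⟩ | ⟨rfl, -, b, hb, hbC, h⟩ | ⟨-, h, -⟩
        · obtain ⟨L, hL, h⟩ := ih hi hl ⟨s, h⟩
          exact ⟨L, hmono hL, h⟩
        · obtain ⟨L, hL, h⟩ := ih hbC hl h
          exact hone L hL b hb l hlv h
        · exact (hvC h).elim

/-- The global Markov property. -/
theorem condCov_eq_zero_of_dSep (hG : IsDAG G) {S : Matrix V V ℝ} (hS : S ∈ dagModel G)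
    {C : Finset V} {i l : V} (hi : i ∉ C) (hl : l ∉ C) (h : DSep G {i} {l} C) :
    condCov S C i l = 0 := by
  obtain ⟨⟨L, w⟩, ⟨hL, hw⟩, rfl⟩ := hS
  by_contra hne
  obtain ⟨s, hs⟩ := exists_active_of_condCov_ne_zero hG hw Finset.univ (fun _ _ _ _ => by simp)
    (by rwa [restrictHeads_univ]) hi hl hne
  rw [restrictHeads_univ] at hs
  exact not_dSep_of_active hG hl hi hs h

/-- Vertices that are not d-separated are dependent for some choice of edge weights. -/
theorem exists_condCov_ne_zero_of_not_dSep (hG : IsDAG G) {w : V → ℝ} (hw : ∀ v, 0 < w v)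
    {C : Finset V} {i l : V} (hi : i ∉ C) (hl : l ∉ C) (hil : i ≠ l) (h : ¬ DSep G {i} {l} C) :
    ∃ L ∈ edgeWeights G, condCov (semCov (L, w)) C i l ≠ 0 := by
  have hact := exists_active_of_not_dSep hG hl hil h
  have := exists_condCov_ne_zero_of_active hG hw Finset.univ (fun _ _ _ _ => by simp) hl hi
    (by rwa [restrictHeads_univ])
  rw [restrictHeads_univ] at this
  obtain ⟨L, hL, h⟩ := this
  rw [condCov_comm (semCov_posDef (isUnit_one_sub hG hL) hw)] at h
  exact ⟨L, hL, h⟩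

end Markov

end GaussianDAG

theorem mainTheorem3 {V : Type*} [Fintype V] [DecidableEq V]
    (G : Digraph V) (hG : GaussianDAG.IsDAG G)
    (i j l : V) (K : Finset V)
    (hij : i ≠ j) (hil : i ≠ l) (hjl : j ≠ l)
    (hiK : i ∉ K) (hjK : j ∉ K) (hlK : l ∉ K)
    (hconn_ij : ¬ GaussianDAG.DSep G {i} {j} K)
    (hconn_il : ¬ GaussianDAG.DSep G {i} {l} K) :
    (∀ δ ∈ Set.Icc (0 : ℝ) 1,
        GaussianDAG.dagModel G ∩ GaussianDAG.approxCIModel i j K δ ⊆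
          GaussianDAG.approxCIModel i l K δ) ↔
      GaussianDAG.DSep G {i} {l} (insert j K) := by
  have hi' : i ∉ insert j K := by simp [hij, hiK]
  have hl' : l ∉ insert j K := by simp [hjl.symm, hlK]
  constructor
  · intro h
    by_contra hd
    have hw : ∀ v : V, 0 < (1 : V → ℝ) v := fun _ => one_pos
    obtain ⟨L, hL, h1, h2⟩ := GaussianDAG.exists_condCov_ne_zero_and hG hw
      (GaussianDAG.exists_condCov_ne_zero_of_not_dSep hG hw hiK hlK hil hconn_il)
      (GaussianDAG.exists_condCov_ne_zero_of_not_dSep hG hw hi' hl' hil hd)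
    obtain ⟨S, hS, hSp, hlt⟩ :=
      GaussianDAG.exists_abs_partialCorr_lt hG hL hw hiK hjK hlK hjl h1 h2
    -- The tightest admissible δ for this matrix is |ρ_{ij·K}| itself.
    have := h |GaussianDAG.partialCorr S i j K|
      ⟨abs_nonneg _, GaussianDAG.abs_partialCorr_le_one hSp hiK hjK hij⟩ ⟨hS, hSp, le_rfl⟩
    exact absurd this.2 (not_le.2 hlt)
  · rintro h δ - S ⟨hS, hSp, hle⟩
    refine ⟨hSp, ?_⟩
    rw [GaussianDAG.partialCorr_eq_mul hSp hjK hjl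
      (GaussianDAG.condCov_eq_zero_of_dSep hG hS hi' hl' h), abs_mul]
    exact (mul_le_of_le_one_right (abs_nonneg _)
      (GaussianDAG.abs_partialCorr_le_one hSp hjK hlK hjl)).trans hle
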